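/- Let $\alpha>0$ be real, let $m,n\ge 0$ be integers, and let $a_0,\dots,a_n$ be real numbers with $a_n>0$. Consider the equation $$D^\alpha y(z)=z^m\Bigl(a_nz^n y^{(n)}(z)+a_{n-1}z^{n-1}y^{(n-1)}(z)+\cdots+a_1 z y'(z)+a_0y(z)\Bigr),\qquad z>0,$$ where $D^\alpha$ is the Riemann–Liouville derivative with base point $0$, $$D^\alpha y(z)=\frac{d^N}{dz^N}\,\frac1{\Gamma(N-\alpha)}\int_0^z (z-\tau)^{N-\alpha-1}y(\tau)\,d\tau,\qquad N=[\alpha]+1 .$$ Let $s_1,\dots,s_n\in\mathbb C$ be the roots, listed with multiplicity, of the characteristic polynomial $$\widetilde P(s)=a_n\prod_{j=0}^{n-1}(s-j)+a_{n-1}\prod_{j=0}^{n-2}(s-j)+\cdots+a_1s+a_0 .$$ (1) If $\alpha<n$, then for every constant $c_1\in\mathbb C$ the equation has the solution $$y(z)=c_1\,H^{m+n,0}_{1,m+n}\!\left[\frac{z^{-(\alpha+m)}}{a_n(\alpha+m)^{m+n}}\,\middle|\,\begin{matrix}(1,\alpha+m)\\ \left(-\frac{s_j}{\alpha+m},1\right)_{1,n},\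 \left(\frac{j}{\alpha+m},1\right)_{1,m}\end{matrix}\right].$$ Here, for $x>0$, this Fox $H$-function is the Mellin–Barnes integral $$\frac1{2\pi i}\int_{\gamma-i\infty}^{\gamma+i\infty}\frac{\prod_{j=1}^n\Gamma\!\left(-\frac{s_j}{\alpha+m}-s\right)\prod_{j=1}^m\Gamma\!\left(\frac{j}{\alpha+m}-s\right)}{\Gamma(1-(\alpha+m)s)}\,x^s\,ds ,$$ where $\gamma$ is any real number such that all poles of the Gamma functions in the numerator lie to the right of the line $\operatorname{Re}s=\gamma$. Such $\gamma$ exist, and for each of them the integral converges absolutely for all $x>0$. (2) If $\alpha>n$, then the equation has the solution $$y(z)=\sum_{k=1}^{[\alpha]+1}c_k\,z^{\alpha-k}\;{}_{m+n+1}\Psi_1\!\left[a_n(\alpha+m)^{m+n}z^{\alpha+m}\,\middle|\,\begin{matrix}\left(\frac{\alpha-k-s_i}{\alpha+m},1\right)_{1,n},\ \left(\frac{\alpha-k+i}{\alpha+m},1\right)_{1,m},\ (1,1)\\ (1+\alpha-k,\ \alpha+m)\end{matrix}\right]$$ for all constants $c_k\in\mathbb C$ such that $c_k=0$ for each $k$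 for which the $k$-th Wright function is undefined. Here $${}_{p}\Psi_{q}\!\left[x\,\middle|\,\begin{matrix}(A_i,\alpha_i)_{1,p}\\(B_j,\beta_j)_{1,q}\end{matrix}\right]=\sum_{r=0}^\infty\frac{\prod_{i=1}^p\Gamma(A_i+\alpha_i r)}{\prod_{j=1}^q\Gamma(B_j+\beta_j r)}\frac{x^r}{r!}$$ with $1/\Gamma=0$ at the poles of $\Gamma$; it is undefined if some $A_i+\alpha_i r$ with $r\ge 0$ is one of $0,-1,-2,\dots$. Whenever the $k$-th Wright function, $1\le k\le[\alpha]+1$, is defined, its series converges absolutely for every $x\in\mathbb C$. In both cases, that $y$ is a solution means that $y$ is $n$ times continuously differentiable on $(0,\infty)$, that the integral defining $D^\alpha y$ converges absolutely for every $z>0$ and is $N$ times continuously differentiable in $z$ on $(0,\infty)$, and that the equation holds for all $z>0$. -/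

import Mathlib

open scoped BigOperators

noncomputable section

/-- The integrand of the Mellin-Barnes integral of the Fox function `H^{m,l}_{p,q}[z]`.
The parameter pairs are `a i = (a_i, α_i)` and `b j = (b_j, β_j)` (numbered from `0`). -/
def foxHIntegrand {p q : ℕ} (m l : ℕ) (a : Fin p → ℂ × ℝ) (b : Fin q → ℂ × ℝ) (z s : ℂ) : ℂ :=
  ((∏ j ∈ Finset.univ.filter (fun j : Fin q => (j : ℕ) < m), Complex.Gamma ((b j).1 - (b j).2 * s)) *
      (∏ i ∈ Finset.univ.filter (fun i : Fin p => (i : ℕ) < l), Complex.Gamma (1 - (a i).1 + (a i).2 * s))) /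
    ((∏ i ∈ Finset.univ.filter (fun i : Fin p => l ≤ (i : ℕ)), Complex.Gamma ((a i).1 - (a i).2 * s)) *
      (∏ j ∈ Finset.univ.filter (fun j : Fin q => m ≤ (j : ℕ)), Complex.Gamma (1 - (b j).1 + (b j).2 * s))) * z ^ s

/-- The vertical line `Re s = γ` has all the poles of the factors `Γ(b_j - β_j s)`, `j ≤ m`, on its
right and all the poles of the factors `Γ(1 - a_i + α_i s)`, `i ≤ l`, on its left
(for positive `α_i`, `β_j`). -/
def FoxHSeparates {p q : ℕ} (m l : ℕ) (a : Fin p → ℂ × ℝ) (b : Fin q → ℂ × ℝ) (γ : ℝ) : Prop :=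
  (∀ j : Fin q, (j : ℕ) < m → (b j).2 * γ < (b j).1.re) ∧
    (∀ i : Fin p, (i : ℕ) < l → (a i).1.re - 1 < (a i).2 * γ)

/-- The Fox function `H^{m,l}_{p,q}[z]`, the integral `(1 / (2πi)) ∫ … ds` being taken upwards along
the vertical line `Re s = γ`, parametrised as `s = γ + i t`. -/
def foxH {p q : ℕ} (m l : ℕ) (a : Fin p → ℂ × ℝ) (b : Fin q → ℂ × ℝ) (γ : ℝ) (z : ℂ) : ℂ :=
  (1 / (2 * Real.pi * Complex.I)) *
    ∫ t : ℝ, foxHIntegrand m l a b z (γ + t * Complex.I) * Complex.I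

/-- The Mellin-Barnes integral along `Re s = γ` converges absolutely. -/
def FoxHConverges {p q : ℕ} (m l : ℕ) (a : Fin p → ℂ × ℝ) (b : Fin q → ℂ × ℝ)
    (γ : ℝ) (z : ℂ) : Prop :=
  MeasureTheory.Integrable (fun t : ℝ => foxHIntegrand m l a b z (γ + t * Complex.I))

/-- The `k`-th term of the series of the generalized Wright function `pΨq[z]`. -/
def wrightTerm {p q : ℕ} (a : Fin p → ℂ × ℝ) (b : Fin q → ℂ × ℝ) (z : ℂ) (k : ℕ) : ℂ :=
  (∏ i, Complex.Gamma ((a i).1 + (a i).2 * k)) / (∏ j, Complex.Gamma ((b j).1 + (b j).2 * k)) *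
    (z ^ k / (k.factorial : ℂ))

/-- The generalized Wright function `pΨq[z]`. -/
def wrightPsi {p q : ℕ} (a : Fin p → ℂ × ℝ) (b : Fin q → ℂ × ℝ) (z : ℂ) : ℂ :=
  ∑' k : ℕ, wrightTerm a b z k

/-- No Gamma function in a numerator of the Wright series is evaluated at a pole, so that every
term of the series is defined (a pole in a denominator only makes the term vanish). -/
def WrightDefined {p : ℕ} (a : Fin p → ℂ × ℝ) : Prop :=
  ∀ (i : Fin p) (k r : ℕ), (a i).1 + (a i).2 * k ≠ -(r : ℂ)

/-- The Riemann-Liouville fractional integral of order `β > 0` with base point `0`. -/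
def rlIntegral (β : ℝ) (y : ℝ → ℂ) (z : ℝ) : ℂ :=
  ((1 / Real.Gamma β : ℝ) : ℂ) * ∫ τ in (0 : ℝ)..z, (((z - τ) ^ (β - 1) : ℝ) : ℂ) * y τ

/-- The Riemann-Liouville fractional derivative of order `α ≥ 0` with base point `0`:
`D^α y = (d/dz)^N I^{N-α} y` with `N = [α] + 1`. -/
def rlDeriv (α : ℝ) (y : ℝ → ℂ) (z : ℝ) : ℂ :=
  iteratedDeriv (⌊α⌋₊ + 1) (rlIntegral ((⌊α⌋₊ + 1 : ℕ) - α) y) z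

/-- The Riemann-Liouville derivative of order `α` of `y` exists on `(0, ∞)`: the fractional
integral of order `N - α` converges absolutely at every `z > 0` and is `N` times continuously
differentiable there, where `N = [α] + 1`. -/
def HasRLDeriv (α : ℝ) (y : ℝ → ℂ) : Prop :=
  (∀ z : ℝ, 0 < z → IntervalIntegrable
      (fun τ : ℝ => (((z - τ) ^ (((⌊α⌋₊ + 1 : ℕ) : ℝ) - α - 1) : ℝ) : ℂ) * y τ)
      MeasureTheory.volume 0 z) ∧
    ContDiffOn ℝ (⌊α⌋₊ + 1 : ℕ) (rlIntegral ((⌊α⌋₊ + 1 : ℕ) - α) y) (Set.Ioi 0)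

/-- `y` solves, on `z > 0`, the equation
`D^α y = z^m (a_n z^n y^(n) + ... + a_1 z y' + a_0 y)`. -/
def IsEulerSolution (α : ℝ) (m n : ℕ) (a : ℕ → ℝ) (y : ℝ → ℂ) : Prop :=
  ContDiffOn ℝ n y (Set.Ioi 0) ∧ HasRLDeriv α y ∧
    ∀ z : ℝ, 0 < z → rlDeriv α y z =
      (z : ℂ) ^ m * ∑ k ∈ Finset.range (n + 1), (a k : ℂ) * (z : ℂ) ^ k * iteratedDeriv k y z

/-- The characteristic polynomial
`a_n s (s-1) ⋯ (s-n+1) + ⋯ + a_1 s + a_0`. -/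
def eulerCharPoly (n : ℕ) (a : ℕ → ℝ) : Polynomial ℂ :=
  ∑ k ∈ Finset.range (n + 1),
    Polynomial.C (a k : ℂ) * ∏ j ∈ Finset.range k, (Polynomial.X - Polynomial.C (j : ℂ))

/-- The upper parameter `(1, α + m)` of the `H`-function. -/
def hUpper (α : ℝ) (m : ℕ) : Fin 1 → ℂ × ℝ := fun _ => (1, α + m)

/-- The lower parameters `(-s_j / (α + m), 1)`, `1 ≤ j ≤ n`, and `(j / (α + m), 1)`, `1 ≤ j ≤ m`,
of the `H`-function. -/
def hLower (α : ℝ) (m n : ℕ) (s : Fin n → ℂ) : Fin (n + m) → ℂ × ℝ :=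
  Fin.append (fun j : Fin n => (-(s j) / ((α + m : ℝ) : ℂ), (1 : ℝ)))
    (fun j : Fin m => ((((j : ℕ) + 1 : ℝ) / (α + m) : ℝ), (1 : ℝ)))

/-- The upper parameters `((α - k - s_i) / (α + m), 1)`, `1 ≤ i ≤ n`,
`((α - k + i) / (α + m), 1)`, `1 ≤ i ≤ m`, and `(1, 1)` of the `k`-th Wright function. -/
def psiUpper (α : ℝ) (m n : ℕ) (s : Fin n → ℂ) (k : ℕ) : Fin (n + m + 1) → ℂ × ℝ :=
  Fin.append
    (Fin.append (fun i : Fin n => ((((α - k : ℝ) : ℂ) - s i) / ((α + m : ℝ) : ℂ), (1 : ℝ)))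
      (fun i : Fin m => (((α - k + ((i : ℕ) + 1 : ℝ)) / (α + m) : ℝ), (1 : ℝ))))
    (fun _ : Fin 1 => ((1 : ℂ), (1 : ℝ)))

/-- The lower parameter `(1 + α - k, α + m)` of the `k`-th Wright function. -/
def psiLower (α : ℝ) (m k : ℕ) : Fin 1 → ℂ × ℝ := fun _ => ((1 + α - k : ℝ), α + m)

end

/-! Put `σ = α + m` and `C = a n * σ ^ (m + n)`. Both solutions are superpositions of powers `z ^
p`: over a vertical line with Lebesgue measure in (1), over `ℕ` with counting measure in (2). On `z
^ p` with `Re p > -1` the derivative `D^α` gives `Γ(p+1)/Γ(p+1-α) * z ^ (p-α)`, and the right-hand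
side of the equation gives `P(p) * z ^ (p+m)`. The two exponents differ by `σ`, so the equation
becomes a recursion of step `σ` for the weight `φ`: `φ(q+σ) Γ(q+σ+1)/Γ(q+1+m) = φ(q) P(q)`. Since
`P(q) = a n * ∏ (q - s i)` and `Γ(q+1+m)/Γ(q+1) = (q+1)⋯(q+m)`, it is solved by `C^(q/σ) ∏ Γ((q - s
i)/σ) ∏ Γ((q+i)/σ) / Γ(q+1)` with `1 ≤ i ≤ m` in the second product; this is
`gammaProd_add_div_Gamma`.

In (1), `q = -σw`, and the step `q ↦ q+σ` is the shift `w ↦ w-1` of the contour. Cauchy's theorem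
allows it (`integral_vertical_eq`), as there are no poles on the left. The `m+n` Gamma factors decay
like `exp(-π|t|/2)` each, against a growth `exp(σπ|t|/2)` of the denominator, so `σ < m+n` gives
absolute convergence.

In (2), `q = α-k+σr`, and the step is `r ↦ r+1`. The unmatched term `r = 0` of `D^α y` carries
`1/Γ(1-k) = 0`. Consecutive terms have a ratio of order `q^(m+n-σ)`, so `σ > m+n` gives convergence
everywhere.

Termwise calculation is justified once for both cases, through `PowerDecay`: differentiation under
the integral, and Fubini with Beta integrals for the fractional integral. -/

open MeasureTheory Set Filter Topology


/-! ### Superpositions of powers and their derivatives -/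

section PowerIntegrals

variable {X : Type*} [MeasurableSpace X] {μ : Measure X}

/-- The superposition `∫ g x * z ^ p x ∂μ` of complex powers of `z`. -/
noncomputable def powInt (μ : Measure X) (g p : X → ℂ) (z : ℝ) : ℂ :=
  ∫ x, g x * (z : ℂ) ^ p x ∂μ

/-- The superposition of powers with weight `g` and exponents `p` converges absolutely on `(0, ∞)`,
also after multiplication of the weight with any polynomial in the exponents. -/
structure PowerDecay (μ : Measure X) (g p : X → ℂ) : Prop where
  measurable_weight : Measurable g
  measurable_exponent : Measurable p
  integrable_bound : ∀ (k : ℕ) (z : ℝ), 0 < z →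
    Integrable (fun x => ‖g x‖ * (1 + ‖p x‖) ^ k * z ^ (p x).re) μ

namespace PowerDecay

variable {g p : X → ℂ}

/-- The bound is asked only where the weight is nonzero: a Wright series may contain an exponent
`-1` whose coefficient vanishes. -/
theorem mul_of_norm_le (h : PowerDecay μ g p) {f : X → ℂ} (hf : Measurable f) (M : ℝ) (j : ℕ)
    (hM : ∀ x, g x ≠ 0 → ‖f x‖ ≤ M * (1 + ‖p x‖) ^ j) :
    PowerDecay μ (fun x => g x * f x) p where
  measurable_weight := h.measurable_weight.mul hf
  measurable_exponent := h.measurable_exponent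
  integrable_bound k z hz := by
    have hp := h.measurable_exponent
    have hg := h.measurable_weight
    refine ((h.integrable_bound (j + k) z hz).const_mul M).mono' ?_ (.of_forall fun x => ?_)
    · exact Measurable.aestronglyMeasurable (by fun_prop)
    · have h1 : 0 ≤ z ^ (p x).re := (Real.rpow_pos_of_pos hz _).le
      rw [Real.norm_of_nonneg (by positivity), norm_mul]
      by_cases h0 : g x = 0
      · simp [h0]
      · calc ‖g x‖ * ‖f x‖ * (1 + ‖p x‖) ^ k * z ^ (p x).re
            ≤ ‖g x‖ * (M * (1 + ‖p x‖) ^ j) * (1 + ‖p x‖) ^ k * z ^ (p x).re := by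
              gcongr; exact hM x h0
          _ = _ := by rw [pow_add]; ring

theorem add_exponent (h : PowerDecay μ g p) (b : ℂ) : PowerDecay μ g (fun x => p x + b) where
  measurable_weight := h.measurable_weight
  measurable_exponent := h.measurable_exponent.add_const b
  integrable_bound k z hz := by
    have hp := h.measurable_exponent
    have hg := h.measurable_weight
    refine ((h.integrable_bound k z hz).const_mul ((1 + ‖b‖) ^ k * z ^ b.re)).mono' ?_
      (.of_forall fun x => ?_)
    · exact Measurable.aestronglyMeasurable (by fun_prop)
    · have h1 : 0 < z ^ (p x).re := Real.rpow_pos_of_pos hz _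
      have h2 : 0 < z ^ b.re := Real.rpow_pos_of_pos hz _
      rw [Complex.add_re, Real.rpow_add hz, Real.norm_of_nonneg (by positivity)]
      have h3 : 1 + ‖p x + b‖ ≤ (1 + ‖b‖) * (1 + ‖p x‖) := by
        nlinarith [norm_add_le (p x) b, norm_nonneg b, norm_nonneg (p x),
          mul_nonneg (norm_nonneg b) (norm_nonneg (p x))]
      calc ‖g x‖ * (1 + ‖p x + b‖) ^ k * (z ^ (p x).re * z ^ b.re)
          ≤ ‖g x‖ * ((1 + ‖b‖) * (1 + ‖p x‖)) ^ k * (z ^ (p x).re * z ^ b.re) := by gcongr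
        _ = _ := by rw [mul_pow]; ring

theorem mul_exponent_sub (h : PowerDecay μ g p) (c : ℂ) :
    PowerDecay μ (fun x => g x * (p x - c)) p := by
  refine h.mul_of_norm_le (h.measurable_exponent.sub_const c) (1 + ‖c‖) 1 fun x _ => ?_
  nlinarith [norm_sub_le (p x) c, norm_nonneg c, norm_nonneg (p x),
    mul_nonneg (norm_nonneg c) (norm_nonneg (p x))]

theorem mul_prod (h : PowerDecay μ g p) (k : ℕ) :
    PowerDecay μ (fun x => g x * ∏ j ∈ Finset.range k, (p x - j)) p := by
  induction k with
  | zero => simpa using h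
  | succ k ih =>
    have := ih.mul_exponent_sub (k : ℂ)
    simpa only [Finset.prod_range_succ, mul_assoc] using this

theorem integrable (h : PowerDecay μ g p) {z : ℝ} (hz : 0 < z) :
    Integrable (fun x => g x * (z : ℂ) ^ p x) μ := by
  have hp := h.measurable_exponent
  have hg := h.measurable_weight
  refine (h.integrable_bound 0 z hz).mono' (Measurable.aestronglyMeasurable (by fun_prop))
    (.of_forall fun x => ?_)
  simp [Complex.norm_cpow_eq_rpow_re_of_pos hz]

/-- Dominated differentiation on `(z/2, 2z)`: `w ^ Re(p-1)` is monotone in `w`, hence at most the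
sum of its values at the two endpoints. -/
theorem hasDerivAt (h : PowerDecay μ g p) {z : ℝ} (hz : 0 < z) :
    HasDerivAt (powInt μ g p) (powInt μ (fun x => g x * p x) (fun x => p x - 1) z) z := by
  have hp := h.measurable_exponent
  have hg := h.measurable_weight
  have h' : PowerDecay μ g (fun x => p x - 1) := by
    simpa [sub_eq_add_neg] using h.add_exponent (-1)
  have hm : ∀ w : ℝ, Measurable fun x => g x * (w : ℂ) ^ p x := fun w => by fun_prop
  have hm' : ∀ w : ℝ, Measurable fun x => g x * p x * (w : ℂ) ^ (p x - 1) := fun w => by fun_prop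
  have h2 : PowerDecay μ (fun x => g x * p x) p := by simpa using h.mul_exponent_sub 0
  have h3 : PowerDecay μ (fun x => g x * p x) (fun x => p x - 1) := by
    simpa [sub_eq_add_neg] using h2.add_exponent (-1)
  refine (hasDerivAt_integral_of_dominated_loc_of_deriv_le
    (F := fun (w : ℝ) x => g x * (w : ℂ) ^ p x)
    (F' := fun (w : ℝ) x => g x * p x * (w : ℂ) ^ (p x - 1))
    (bound := fun x => ‖g x * p x‖ * (1 + ‖p x - 1‖) ^ 0 * (z / 2) ^ (p x - 1).re +
      ‖g x * p x‖ * (1 + ‖p x - 1‖) ^ 0 * (2 * z) ^ (p x - 1).re)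
    (Ioo_mem_nhds (show z / 2 < z by linarith) (show z < 2 * z by linarith))
    (.of_forall fun w => (hm w).aestronglyMeasurable) (h.integrable hz)
    (hm' z).aestronglyMeasurable (.of_forall fun x w hw => ?_)
    ((h3.integrable_bound 0 _ (by positivity)).add (h3.integrable_bound 0 _ (by positivity)))
    (.of_forall fun x w hw => ?_)).2
  · have hw0 : 0 < w := lt_trans (by positivity) hw.1
    rw [norm_mul, Complex.norm_cpow_eq_rpow_re_of_pos hw0]
    simp only [pow_zero, mul_one]
    rw [← mul_add]
    refine mul_le_mul_of_nonneg_left ?_ (norm_nonneg _)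
    have p1 : 0 < (z / 2) ^ (p x - 1).re := Real.rpow_pos_of_pos (by positivity) _
    have p2 : 0 < (2 * z) ^ (p x - 1).re := Real.rpow_pos_of_pos (by positivity) _
    rcases le_total 0 (p x - 1).re with h0 | h0
    · have := Real.rpow_le_rpow hw0.le hw.2.le h0
      linarith
    · have := Real.rpow_le_rpow_of_nonpos (by positivity) hw.1.le h0
      linarith
  · have hw0 : 0 < w := lt_trans (by positivity) hw.1
    simp only [mul_assoc]
    refine HasDerivAt.const_mul _ ?_
    by_cases hp0 : p x = 0
    · simpa [hp0] using hasDerivAt_const w (1 : ℂ)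
    · exact hasDerivAt_ofReal_cpow_const hw0.ne' hp0

theorem contDiffOn (h : PowerDecay μ g p) (k : ℕ) : ContDiffOn ℝ k (powInt μ g p) (Ioi 0) := by
  induction k generalizing g p with
  | zero =>
    rw [Nat.cast_zero, contDiffOn_zero]
    exact fun z hz => (h.hasDerivAt hz).continuousAt.continuousWithinAt
  | succ k ih =>
    rw [Nat.cast_add, Nat.cast_one, contDiffOn_succ_iff_deriv_of_isOpen isOpen_Ioi]
    refine ⟨fun z hz => (h.hasDerivAt hz).differentiableAt.differentiableWithinAt, by simp, ?_⟩
    have h2 : PowerDecay μ (fun x => g x * p x) p := by simpa using h.mul_exponent_sub 0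
    have h3 : PowerDecay μ (fun x => g x * p x) (fun x => p x - 1) := by
      simpa [sub_eq_add_neg] using h2.add_exponent (-1)
    exact (ih h3).congr fun z hz => (h.hasDerivAt hz).deriv

theorem iteratedDeriv_eq (h : PowerDecay μ g p) (k : ℕ) {z : ℝ} (hz : 0 < z) :
    iteratedDeriv k (powInt μ g p) z =
      powInt μ (fun x => g x * ∏ j ∈ Finset.range k, (p x - j)) (fun x => p x - k) z := by
  induction k generalizing z with
  | zero => simp
  | succ k ih =>
    have hd : PowerDecay μ (fun x => g x * ∏ j ∈ Finset.range k, (p x - j)) (fun x => p x - k) := by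
      simpa [sub_eq_add_neg] using (h.mul_prod k).add_exponent (-(k : ℂ))
    rw [iteratedDeriv_succ]
    have : iteratedDeriv k (powInt μ g p) =ᶠ[𝓝 z]
        powInt μ (fun x => g x * ∏ j ∈ Finset.range k, (p x - j)) (fun x => p x - k) := by
      filter_upwards [Ioi_mem_nhds hz] with w hw using ih hw
    rw [this.deriv_eq, (hd.hasDerivAt hz).deriv]
    simp only [Finset.prod_range_succ, mul_assoc, Nat.cast_add, Nat.cast_one, sub_sub]

end PowerDecay

end PowerIntegrals

/-! ### Bounds for the Gamma function on vertical strips -/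

section GammaBounds

theorem betaIntegral_ofReal_eq (x v : ℝ) :
    Complex.betaIntegral x v =
      ((∫ t in (0 : ℝ)..1, t ^ (x - 1) * (1 - t) ^ (v - 1) : ℝ) : ℂ) := by
  rw [Complex.betaIntegral, ← intervalIntegral.integral_ofReal]
  refine intervalIntegral.integral_congr fun t ht => ?_
  rw [uIcc_of_le zero_le_one] at ht
  have h1 : (0 : ℝ) ≤ 1 - t := by linarith [ht.2]
  simp only [Complex.ofReal_mul]
  rw [Complex.ofReal_cpow ht.1, Complex.ofReal_cpow h1]
  push_cast
  rfl

theorem norm_betaIntegral_le {s : ℂ} {ε v : ℝ} (hε : 0 < ε) (hs : ε ≤ s.re) (hv : 0 < v) :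
    ‖Complex.betaIntegral s v‖ ≤ ∫ t in (0 : ℝ)..1, t ^ (ε - 1) * (1 - t) ^ (v - 1) := by
  rw [Complex.betaIntegral]
  refine intervalIntegral.norm_integral_le_of_norm_le zero_le_one ?_ ?_
  · have hne : ∀ᵐ t : ℝ, t ≠ 1 := by simp [ae_iff]
    filter_upwards [hne] with t ht1 ht
    have h1 : (0 : ℝ) < 1 - t := by
      have := lt_of_le_of_ne ht.2 ht1
      linarith
    rw [norm_mul, Complex.norm_cpow_eq_rpow_re_of_pos ht.1]
    have : (1 - (t : ℂ)) = ((1 - t : ℝ) : ℂ) := by push_cast; rfl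
    rw [this, Complex.norm_cpow_eq_rpow_re_of_pos h1]
    simp only [Complex.sub_re, Complex.one_re, Complex.ofReal_re]
    refine mul_le_mul_of_nonneg_right ?_ (Real.rpow_nonneg h1.le _)
    exact Real.rpow_le_rpow_of_exponent_ge ht.1 ht.2 (by linarith)
  -- A non-integrable function would have integral `0` by default, but this integral is a Beta value
  -- and so nonzero.
  · refine intervalIntegral.intervalIntegrable_of_integral_ne_zero fun h0 => ?_
    have h := Complex.Gamma_mul_Gamma_eq_betaIntegral (s := ε) (t := v) (by simpa) (by simpa)
    rw [betaIntegral_ofReal_eq, h0, Complex.ofReal_zero, mul_zero] at h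
    exact mul_ne_zero (Complex.Gamma_ne_zero_of_re_pos (by simpa))
      (Complex.Gamma_ne_zero_of_re_pos (by simpa)) h

/-- In `Γ(s)Γ(v) = Γ(s+v)B(s,v)` one has `|B(s,v)| ≤ B(ε,v)`. This carries estimates from one
vertical line to another, and bounds the factor produced by fractional integration. -/
theorem norm_Gamma_mul_Gamma_le {s : ℂ} {ε v : ℝ} (hε : 0 < ε) (hs : ε ≤ s.re) (hv : 0 < v) :
    ‖Complex.Gamma s‖ * Real.Gamma (ε + v) ≤ Real.Gamma ε * ‖Complex.Gamma (s + v)‖ := by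
  have h1 := Complex.Gamma_mul_Gamma_eq_betaIntegral (s := s) (t := v) (by linarith) (by simpa)
  have h2 := Complex.Gamma_mul_Gamma_eq_betaIntegral (s := ε) (t := v) (by simpa) (by simpa)
  rw [betaIntegral_ofReal_eq] at h2
  have h3 := norm_betaIntegral_le hε hs hv
  set b := ∫ t in (0 : ℝ)..1, t ^ (ε - 1) * (1 - t) ^ (v - 1)
  rw [← Complex.ofReal_add, Complex.Gamma_ofReal, Complex.Gamma_ofReal, Complex.Gamma_ofReal] at h2
  have h2' : Real.Gamma ε * Real.Gamma v = Real.Gamma (ε + v) * b := by exact_mod_cast h2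
  have h1' := congrArg norm h1
  rw [norm_mul, norm_mul, Complex.Gamma_ofReal, Complex.norm_real,
    Real.norm_of_nonneg (Real.Gamma_pos_of_pos hv).le] at h1'
  have hv' := Real.Gamma_pos_of_pos hv
  have he' := Real.Gamma_pos_of_pos (add_pos hε hv)
  refine le_of_mul_le_mul_right ?_ hv'
  calc ‖Complex.Gamma s‖ * Real.Gamma (ε + v) * Real.Gamma v
      = ‖Complex.Gamma (s + v)‖ * ‖Complex.betaIntegral s v‖ * Real.Gamma (ε + v) := by
        rw [← h1']; ring
    _ ≤ ‖Complex.Gamma (s + v)‖ * b * Real.Gamma (ε + v) := by gcongr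
    _ = ‖Complex.Gamma (s + v)‖ * (Real.Gamma (ε + v) * b) := by ring
    _ = _ := by rw [← h2']; ring

/-- This is `x^k/k! ≤ e^x` at `x = η(1+u)`; it absorbs polynomial factors into an arbitrarily small
exponential. -/
theorem one_add_pow_le_exp {η : ℝ} (hη : 0 < η) (k : ℕ) {u : ℝ} (hu : 0 ≤ u) :
    (1 + u) ^ k ≤ (k.factorial / η ^ k * Real.exp η) * Real.exp (η * u) := by
  have h := Real.pow_div_factorial_le_exp (η * (1 + u)) (by positivity) k
  rw [div_le_iff₀ (by positivity), mul_pow] at h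
  rw [mul_assoc, ← Real.exp_add, show η + η * u = η * (1 + u) by ring, div_mul_eq_mul_div,
    le_div_iff₀ (by positivity)]
  linarith

/-- On `Re s = 1/2` the reflection `1-s` is the conjugate of `s`, so the reflection formula computes
`|Γ(s)|²`. -/
theorem norm_Gamma_half_sq (y : ℝ) :
    ‖Complex.Gamma (1 / 2 + y * Complex.I)‖ ^ 2 = Real.pi / Real.cosh (Real.pi * y) := by
  have h := Complex.Gamma_mul_Gamma_one_sub (1 / 2 + y * Complex.I)
  have h1 : 1 - (1 / 2 + (y : ℂ) * Complex.I) = (starRingEnd ℂ) (1 / 2 + y * Complex.I) := by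
    simp only [map_add, map_mul, Complex.conj_I, Complex.conj_ofReal, map_div₀, map_one,
      map_ofNat]
    ring
  rw [h1, Complex.Gamma_conj, Complex.mul_conj, Complex.normSq_eq_norm_sq] at h
  have h2 : (Real.pi : ℂ) * (1 / 2 + y * Complex.I) =
      ((Real.pi * y : ℝ) : ℂ) * Complex.I + (Real.pi : ℂ) / 2 := by push_cast; ring
  rw [h2, Complex.sin_add_pi_div_two, Complex.cos_mul_I, ← Complex.ofReal_cosh] at h
  exact_mod_cast h

theorem norm_Gamma_half_le (y : ℝ) :
    ‖Complex.Gamma (1 / 2 + y * Complex.I)‖ ≤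
      Real.sqrt (2 * Real.pi) * Real.exp (-(Real.pi / 2 * |y|)) := by
  refine le_of_sq_le_sq ?_ (by positivity)
  rw [norm_Gamma_half_sq, mul_pow, Real.sq_sqrt (by positivity), ← Real.exp_nat_mul,
    div_le_iff₀ (Real.cosh_pos _), ← Real.cosh_abs, abs_mul, abs_of_pos Real.pi_pos,
    Real.cosh_eq]
  have : Real.exp (((2 : ℕ) : ℝ) * -(Real.pi / 2 * |y|)) * Real.exp (Real.pi * |y|) = 1 := by
    rw [← Real.exp_add]; simp; ring
  have h3 : 0 < Real.exp (((2 : ℕ) : ℝ) * -(Real.pi / 2 * |y|)) * Real.exp (-(Real.pi * |y|)) := by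
    positivity
  nlinarith [Real.pi_pos]

theorem le_norm_Gamma_half (y : ℝ) :
    Real.exp (-(Real.pi / 2 * |y|)) ≤ ‖Complex.Gamma (1 / 2 + y * Complex.I)‖ := by
  refine le_of_sq_le_sq ?_ (norm_nonneg _)
  rw [norm_Gamma_half_sq, ← Real.exp_nat_mul,
    le_div_iff₀ (Real.cosh_pos _), ← Real.cosh_abs, abs_mul, abs_of_pos Real.pi_pos,
    Real.cosh_eq]
  have : Real.exp (((2 : ℕ) : ℝ) * -(Real.pi / 2 * |y|)) * Real.exp (Real.pi * |y|) = 1 := by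
    rw [← Real.exp_add]; simp; ring
  have h3 : Real.exp (((2 : ℕ) : ℝ) * -(Real.pi / 2 * |y|)) * Real.exp (-(Real.pi * |y|)) ≤ 1 := by
    rw [← Real.exp_add, Real.exp_le_one_iff]
    have : 0 ≤ Real.pi * |y| := by positivity
    push_cast; linarith
  nlinarith [Real.pi_gt_three]

/-- Each use of `Γ(s+1) = sΓ(s)` costs a linear factor, paid for with half of `η`. -/
theorem exists_norm_Gamma_nat_add_half_le (k : ℕ) {η : ℝ} (hη : 0 < η) :
    ∃ M, 0 ≤ M ∧ ∀ y : ℝ, ‖Complex.Gamma ((k + 1 / 2 : ℝ) + y * Complex.I)‖ ≤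
      M * Real.exp (-((Real.pi / 2 - η) * |y|)) := by
  induction k generalizing η with
  | zero =>
    refine ⟨Real.sqrt (2 * Real.pi), by positivity, fun y => ?_⟩
    have h := norm_Gamma_half_le y
    simp only [CharP.cast_eq_zero, zero_add]
    push_cast
    refine h.trans ?_
    gcongr
    linarith
  | succ k ih =>
    obtain ⟨M, hM0, hM⟩ := ih (half_pos hη)
    refine ⟨(k + 1) * ((Nat.factorial 1) / (η / 2) ^ 1 * Real.exp (η / 2)) * M, by positivity,
      fun y => ?_⟩
    have hs : (((k + 1 : ℕ) + 1 / 2 : ℝ) + y * Complex.I : ℂ) =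
        ((k + 1 / 2 : ℝ) + y * Complex.I) + 1 := by push_cast; ring
    have hne : (((k + 1 / 2 : ℝ) : ℂ) + y * Complex.I) ≠ 0 := fun h => by
      have := congrArg Complex.re h
      simp at this
      have hk : (0 : ℝ) ≤ k := k.cast_nonneg
      linarith
    rw [hs, Complex.Gamma_add_one _ hne, norm_mul]
    have h1 : ‖(((k + 1 / 2 : ℝ) : ℂ) + y * Complex.I)‖ ≤ (k + 1) * (1 + |y|) ^ 1 := by
      refine (norm_add_le _ _).trans ?_
      rw [norm_mul, Complex.norm_I, Complex.norm_real, Complex.norm_real,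
        Real.norm_of_nonneg (by positivity), Real.norm_eq_abs]
      have hk : (0 : ℝ) ≤ k := k.cast_nonneg
      nlinarith [abs_nonneg y, mul_nonneg hk (abs_nonneg y)]
    have h2 := one_add_pow_le_exp (half_pos hη) 1 (abs_nonneg y)
    have h3 : Real.exp (-((Real.pi / 2 - η) * |y|)) =
        Real.exp (η / 2 * |y|) * Real.exp (-((Real.pi / 2 - η / 2) * |y|)) := by
      rw [← Real.exp_add]; congr 1; ring
    calc _ ≤ ((k + 1) * (((Nat.factorial 1) / (η / 2) ^ 1 * Real.exp (η / 2)) *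
          Real.exp (η / 2 * |y|))) * (M * Real.exp (-((Real.pi / 2 - η / 2) * |y|))) := by
          refine mul_le_mul (h1.trans ?_) (hM y) (norm_nonneg _) (by positivity)
          gcongr
      _ = _ := by rw [h3]; ring

/-- Exponential decay of the Gamma function on vertical strips in the right half plane. -/
theorem exists_norm_Gamma_le {x₁ : ℝ} (hx₁ : 0 < x₁) (x₂ : ℝ) {η : ℝ} (hη : 0 < η) :
    ∃ M, 0 ≤ M ∧ ∀ s : ℂ, x₁ ≤ s.re → s.re ≤ x₂ →
      ‖Complex.Gamma s‖ ≤ M * Real.exp (-((Real.pi / 2 - η) * |s.im|)) := by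
  obtain ⟨k, hk⟩ := exists_nat_gt x₂
  obtain ⟨M, hM0, hM⟩ := exists_norm_Gamma_nat_add_half_le k hη
  obtain ⟨G, hG⟩ := (isCompact_Icc (a := x₁) (b := x₂)).exists_bound_of_continuousOn
    (f := Real.Gamma) fun x hx => (Real.differentiableAt_Gamma fun j h => by
      have := hx.1; have hj : (0 : ℝ) ≤ j := j.cast_nonneg; linarith).continuousAt.continuousWithinAt
  have hΓ : 0 < Real.Gamma (k + 1 / 2) := Real.Gamma_pos_of_pos (by positivity)
  refine ⟨|G| / Real.Gamma (k + 1 / 2) * M, by positivity, fun s h1 h2 => ?_⟩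
  -- Compares `s` with the point of the same height on the line `Re = k + 1/2`, to the right of the
  -- strip.
  have h := norm_Gamma_mul_Gamma_le (s := s) (ε := s.re) (v := k + 1 / 2 - s.re)
    (by linarith) le_rfl (by linarith)
  rw [add_sub_cancel] at h
  have hs : s + ((k + 1 / 2 - s.re : ℝ) : ℂ) = ((k + 1 / 2 : ℝ) : ℂ) + s.im * Complex.I := by
    push_cast
    linear_combination -(Complex.re_add_im s)
  rw [hs] at h
  have hG' : Real.Gamma s.re ≤ |G| :=
    (le_abs_self _).trans ((hG s.re ⟨h1, h2⟩).trans (le_abs_self _))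
  calc ‖Complex.Gamma s‖ = ‖Complex.Gamma s‖ * Real.Gamma (k + 1 / 2) / Real.Gamma (k + 1 / 2) := by
        field_simp
    _ ≤ |G| * (M * Real.exp (-((Real.pi / 2 - η) * |s.im|))) / Real.Gamma (k + 1 / 2) := by
        refine div_le_div_of_nonneg_right ?_ hΓ.le
        exact h.trans (mul_le_mul hG' (hM _) (norm_nonneg _) (abs_nonneg _))
    _ = _ := by ring

/-- Growth of the reciprocal of the Gamma function on vertical strips. -/
theorem exists_norm_inv_Gamma_le (x₁ x₂ : ℝ) {η : ℝ} (hη : 0 < η) :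
    ∃ M, 0 ≤ M ∧ ∀ s : ℂ, x₁ ≤ s.re → s.re ≤ x₂ →
      ‖(Complex.Gamma s)⁻¹‖ ≤ M * Real.exp ((Real.pi / 2 + η) * |s.im|) := by
  -- The region is extended leftwards from `Re s ≥ 1` one unit at a time by `1/Γ(s) = s/Γ(s+1)`.
  have key : ∀ (k : ℕ) (x₂ : ℝ) (η : ℝ), 0 < η → ∃ M, 0 ≤ M ∧ ∀ s : ℂ, 1 - (k : ℝ) ≤ s.re →
      s.re ≤ x₂ → ‖(Complex.Gamma s)⁻¹‖ ≤ M * Real.exp ((Real.pi / 2 + η) * |s.im|) := by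
    intro k
    induction k with
    | zero =>
      intro x₂ η hη
      obtain ⟨G, hG⟩ := (isCompact_Icc (a := (1 : ℝ)) (b := x₂)).exists_bound_of_continuousOn
        (f := fun x => (Real.Gamma x)⁻¹) fun x hx => by
          have hx0 : (0 : ℝ) < x := by linarith [hx.1]
          refine ((Real.differentiableAt_Gamma fun j h => ?_).continuousAt.inv₀
            (Real.Gamma_pos_of_pos hx0).ne').continuousWithinAt
          have hj : (0 : ℝ) ≤ j := j.cast_nonneg
          linarith
      refine ⟨Real.Gamma (1 / 2) * |G|, ?_, fun s h1 h2 => ?_⟩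
      · have := Real.Gamma_pos_of_pos (show (0 : ℝ) < 1 / 2 by norm_num)
        positivity
      have h1' : 1 ≤ s.re := by simpa using h1
      -- Here `s` lies to the right of the critical line, so the lower bound known there passes to
      -- `|Γ(s)|`.
      have h := norm_Gamma_mul_Gamma_le (s := ((1 / 2 : ℝ) : ℂ) + s.im * Complex.I) (ε := 1 / 2)
        (v := s.re - 1 / 2) (by norm_num) (by simp) (by linarith)
      have hs : ((1 / 2 : ℝ) : ℂ) + s.im * Complex.I + ((s.re - 1 / 2 : ℝ) : ℂ) = s := by
        conv_rhs => rw [← Complex.re_add_im s]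
        push_cast; ring
      rw [hs, add_sub_cancel] at h
      have hl := le_norm_Gamma_half s.im
      push_cast at h
      have hΓ := Real.Gamma_pos_of_pos (show 0 < s.re by linarith)
      have hΓs : 0 < ‖Complex.Gamma s‖ :=
        norm_pos_iff.2 (Complex.Gamma_ne_zero_of_re_pos (by linarith))
      have hG' : (Real.Gamma s.re)⁻¹ ≤ |G| :=
        (le_abs_self _).trans ((hG s.re ⟨h1', h2⟩).trans (le_abs_self _))
      have h5 : Real.exp (-(Real.pi / 2 * |s.im|)) * Real.Gamma s.re ≤
          Real.Gamma (1 / 2) * ‖Complex.Gamma s‖ :=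
        le_trans (mul_le_mul_of_nonneg_right hl hΓ.le) h
      have h12 := Real.Gamma_pos_of_pos (show (0 : ℝ) < 1 / 2 by norm_num)
      rw [norm_inv]
      calc ‖Complex.Gamma s‖⁻¹ ≤
            Real.Gamma (1 / 2) * (Real.Gamma s.re)⁻¹ * Real.exp (Real.pi / 2 * |s.im|) := by
            rw [inv_le_iff_one_le_mul₀ hΓs]
            rw [Real.exp_neg] at h5
            have h6 := Real.exp_pos (Real.pi / 2 * |s.im|)
            rw [inv_mul_le_iff₀ h6] at h5
            calc 1 = Real.Gamma s.re * (Real.Gamma s.re)⁻¹ := (mul_inv_cancel₀ hΓ.ne').symm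
              _ ≤ Real.exp (Real.pi / 2 * |s.im|) *
                  (Real.Gamma (1 / 2) * ‖Complex.Gamma s‖) * (Real.Gamma s.re)⁻¹ := by gcongr
              _ = _ := by ring
        _ ≤ _ := by
            gcongr
            linarith
    | succ k ih =>
      intro x₂ η hη
      obtain ⟨M, hM0, hM⟩ := ih (x₂ + 1) (η / 2) (half_pos hη)
      refine ⟨(k + 1 + |x₂|) * ((Nat.factorial 1) / (η / 2) ^ 1 * Real.exp (η / 2)) * M,
        by positivity, fun s h1 h2 => ?_⟩
      rw [Complex.one_div_Gamma_eq_self_mul_one_div_Gamma_add_one, norm_mul]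
      have h3 := hM (s + 1) (by push_cast at h1; simp; linarith) (by simpa using h2)
      have h4 : ‖s‖ ≤ (k + 1 + |x₂|) * (1 + |s.im|) ^ 1 := by
        refine (Complex.norm_le_abs_re_add_abs_im s).trans ?_
        have : |s.re| ≤ k + |x₂| := by
          push_cast at h1
          rw [abs_le]
          constructor <;> linarith [abs_nonneg x₂, le_abs_self x₂, k.cast_nonneg (α := ℝ)]
        nlinarith [abs_nonneg s.im, mul_nonneg (k.cast_nonneg (α := ℝ)) (abs_nonneg s.im),
          mul_nonneg (abs_nonneg x₂) (abs_nonneg s.im)]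
      have h5 := one_add_pow_le_exp (half_pos hη) 1 (abs_nonneg s.im)
      have h6 : Real.exp ((Real.pi / 2 + η) * |s.im|) =
          Real.exp (η / 2 * |s.im|) * Real.exp ((Real.pi / 2 + η / 2) * |s.im|) := by
        rw [← Real.exp_add]; congr 1; ring
      have h7 : (s + 1).im = s.im := by simp
      rw [h7] at h3
      calc _ ≤ ((k + 1 + |x₂|) * (((Nat.factorial 1) / (η / 2) ^ 1 * Real.exp (η / 2)) *
            Real.exp (η / 2 * |s.im|))) * (M * Real.exp ((Real.pi / 2 + η / 2) * |s.im|)) := by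
            refine mul_le_mul (h4.trans ?_) h3 (norm_nonneg _) (by positivity)
            gcongr
        _ = _ := by rw [h6]; ring
  obtain ⟨k, hk⟩ := exists_nat_gt (1 - x₁)
  obtain ⟨M, hM0, hM⟩ := key k x₂ η hη
  exact ⟨M, hM0, fun s h1 h2 => hM s (by linarith) h2⟩

end GammaBounds

/-! ### Riemann–Liouville calculus of superpositions of powers -/

section RiemannLiouville

theorem integral_sub_rpow_mul_cpow {p : ℂ} (hp : 0 < (p + 1).re) {β : ℝ} (hβ : 0 < β) {z : ℝ}
    (hz : 0 < z) :
    ∫ τ in (0 : ℝ)..z, (((z - τ) ^ (β - 1) : ℝ) : ℂ) * (τ : ℂ) ^ p =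
      (z : ℂ) ^ (p + β) * (Complex.Gamma (p + 1) * Complex.Gamma β / Complex.Gamma (p + 1 + β)) := by
  have h := Complex.betaIntegral_scaled (p + 1) β hz
  have h2 := Complex.Gamma_mul_Gamma_eq_betaIntegral (s := p + 1) (t := β) hp (by simpa)
  have h3 : Complex.Gamma (p + 1 + β) ≠ 0 :=
    Complex.Gamma_ne_zero_of_re_pos (by rw [Complex.add_re, Complex.ofReal_re]; linarith)
  rw [h2, mul_div_cancel_left₀ _ h3]
  have h4 : p + β = p + 1 + β - 1 := by ring
  rw [h4, ← h]
  refine intervalIntegral.integral_congr fun τ hτ => ?_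
  rw [uIcc_of_le hz.le] at hτ
  rw [Complex.ofReal_cpow (by linarith [hτ.2])]
  push_cast
  rw [add_sub_cancel_right]
  ring

theorem integral_sub_rpow_mul_rpow {r : ℝ} (hr : 0 < r + 1) {β : ℝ} (hβ : 0 < β) {z : ℝ}
    (hz : 0 < z) :
    ∫ τ in (0 : ℝ)..z, (z - τ) ^ (β - 1) * τ ^ r =
      z ^ (r + β) * (Real.Gamma (r + 1) * Real.Gamma β / Real.Gamma (r + 1 + β)) := by
  have h := integral_sub_rpow_mul_cpow (p := r) (by simpa using hr) hβ hz
  apply Complex.ofReal_injective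
  rw [← intervalIntegral.integral_ofReal]
  push_cast
  rw [Complex.ofReal_cpow hz.le, ← Complex.Gamma_ofReal, ← Complex.Gamma_ofReal,
    ← Complex.Gamma_ofReal]
  push_cast
  rw [← h]
  refine intervalIntegral.integral_congr fun τ hτ => ?_
  rw [uIcc_of_le hz.le] at hτ
  rw [Complex.ofReal_cpow hτ.1]

theorem intervalIntegrable_sub_rpow_mul_rpow {r : ℝ} (hr : 0 < r + 1) {β : ℝ} (hβ : 0 < β) {z : ℝ}
    (hz : 0 < z) :
    IntervalIntegrable (fun τ : ℝ => (z - τ) ^ (β - 1) * τ ^ r) volume 0 z := by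
  -- Integrability again follows from a nonzero Beta value.
  refine intervalIntegral.intervalIntegrable_of_integral_ne_zero ?_
  rw [integral_sub_rpow_mul_rpow hr hβ hz]
  have h1 := Real.Gamma_pos_of_pos hr
  have h2 := Real.Gamma_pos_of_pos hβ
  have h3 := Real.Gamma_pos_of_pos (add_pos hr hβ)
  have h4 := Real.rpow_pos_of_pos hz (r + β)
  positivity

/-- `1/Γ` is entire, and inversion is measurable. -/
theorem measurable_complex_Gamma : Measurable Complex.Gamma := by
  have := Complex.differentiable_one_div_Gamma.continuous.measurable.inv
  rwa [show (fun s => (Complex.Gamma s)⁻¹)⁻¹ = Complex.Gamma by ext; simp] at this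

variable {X : Type*} [MeasurableSpace X] {μ : Measure X} {g p : X → ℂ}

theorem PowerDecay.mul_Gamma_div (h : PowerDecay μ g p) {ε : ℝ} (hε : 0 < ε)
    (hp : ∀ x, g x ≠ 0 → ε ≤ (p x + 1).re) {β : ℝ} (hβ : 0 < β) :
    PowerDecay μ (fun x => g x * (Complex.Gamma (p x + 1) / Complex.Gamma (p x + 1 + β))) p := by
  have hm := h.measurable_exponent
  refine h.mul_of_norm_le ?_ (Real.Gamma ε / Real.Gamma (ε + β)) 0 fun x hx => ?_
  · exact (measurable_complex_Gamma.comp (hm.add_const 1)).div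
      (measurable_complex_Gamma.comp ((hm.add_const 1).add_const (β : ℂ)))
  · have h1 := norm_Gamma_mul_Gamma_le hε (hp x hx) hβ
    have h2 : 0 < ‖Complex.Gamma (p x + 1 + β)‖ := norm_pos_iff.2
      (Complex.Gamma_ne_zero_of_re_pos (by
        have := hp x hx
        rw [Complex.add_re, Complex.ofReal_re]; linarith))
    rw [norm_div, pow_zero, mul_one, div_le_div_iff₀ h2 (Real.Gamma_pos_of_pos (by positivity))]
    exact h1

/-- The hypothesis of Fubini: integrating the norm over `τ` gives a real Beta integral, that is `z ^
(Re p + β)` times a Gamma quotient bounded for `Re (p+1) ≥ ε`. -/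
theorem PowerDecay.integrable_prod [SFinite μ] (h : PowerDecay μ g p) {ε : ℝ} (hε : 0 < ε)
    (hp : ∀ x, g x ≠ 0 → ε ≤ (p x + 1).re) {β : ℝ} (hβ : 0 < β) {z : ℝ} (hz : 0 < z) :
    Integrable (Function.uncurry fun (τ : ℝ) (x : X) =>
      (((z - τ) ^ (β - 1) : ℝ) : ℂ) * (g x * (τ : ℂ) ^ p x))
      ((volume.restrict (Ioc 0 z)).prod μ) := by
  have hm := h.measurable_exponent
  have hg := h.measurable_weight
  have hnorm : ∀ x, ∀ τ ∈ Ioc 0 z, ‖(((z - τ) ^ (β - 1) : ℝ) : ℂ) * (g x * (τ : ℂ) ^ p x)‖ =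
      ‖g x‖ * ((z - τ) ^ (β - 1) * τ ^ (p x).re) := by
    intro x τ hτ
    rw [norm_mul, norm_mul, Complex.norm_cpow_eq_rpow_re_of_pos hτ.1, Complex.norm_real,
      Real.norm_of_nonneg (Real.rpow_nonneg (by linarith [hτ.2]) _)]
    ring
  have hre : ∀ x, g x ≠ 0 → 0 < (p x).re + 1 := fun x hx => by
    have := hp x hx
    simp only [Complex.add_re, Complex.one_re] at this
    linarith
  rw [integrable_prod_iff']
  · constructor
    · refine .of_forall fun x => ?_
      simp only [Function.uncurry_apply_pair]
      by_cases hx : g x = 0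
      · simp [hx]
      · have hi := (intervalIntegrable_sub_rpow_mul_rpow (hre x hx) hβ hz).const_mul ‖g x‖
        rw [intervalIntegrable_iff_integrableOn_Ioc_of_le hz.le] at hi
        refine Integrable.mono' hi (Measurable.aestronglyMeasurable (by fun_prop)) ?_
        filter_upwards [ae_restrict_mem measurableSet_Ioc] with τ hτ
        exact (hnorm x τ hτ).le
    · have h1 := (h.mul_Gamma_div hε hp hβ).integrable_bound 0 z hz
      have h2 : PowerDecay μ (fun x => g x *
          (Real.Gamma ((p x).re + 1) / Real.Gamma ((p x).re + 1 + β) : ℝ)) p := by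
        refine h.mul_of_norm_le ?_ (Real.Gamma ε / Real.Gamma (ε + β)) 0 fun x hx => ?_
        · have h3 : Measurable fun x => Complex.Gamma (((p x).re + 1 : ℝ) : ℂ) /
              Complex.Gamma (((p x).re + 1 + β : ℝ) : ℂ) :=
            (measurable_complex_Gamma.comp (by fun_prop)).div
              (measurable_complex_Gamma.comp (by fun_prop))
          simpa only [Complex.Gamma_ofReal, ← Complex.ofReal_div] using h3
        · have h1 := norm_Gamma_mul_Gamma_le (s := ((p x).re + 1 : ℝ)) hε
            (by simpa using hp x hx) hβ
          rw [← Complex.ofReal_add, Complex.Gamma_ofReal, Complex.Gamma_ofReal, Complex.norm_real,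
            Complex.norm_real] at h1
          have h2 : 0 < ‖Real.Gamma ((p x).re + 1 + β)‖ := norm_pos_iff.2
            (Real.Gamma_pos_of_pos (add_pos (hre x hx) hβ)).ne'
          rw [Complex.norm_real, norm_div, pow_zero, mul_one,
            div_le_div_iff₀ h2 (Real.Gamma_pos_of_pos (by positivity))]
          exact h1
      refine ((h2.integrable_bound 0 z hz).const_mul (Real.Gamma β * z ^ β)).congr
        (.of_forall fun x => ?_)
      simp only [Function.uncurry_apply_pair]
      rw [setIntegral_congr_fun measurableSet_Ioc (hnorm x), integral_const_mul,
        ← intervalIntegral.integral_of_le hz.le]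
      by_cases hx : g x = 0
      · simp [hx]
      · rw [integral_sub_rpow_mul_rpow (hre x hx) hβ hz, Real.rpow_add hz, norm_mul,
          Complex.norm_real, Real.norm_of_nonneg (div_nonneg
            (Real.Gamma_pos_of_pos (hre x hx)).le
            (Real.Gamma_pos_of_pos (add_pos (hre x hx) hβ)).le)]
        ring
  · exact Measurable.aestronglyMeasurable (by unfold Function.uncurry; fun_prop)

theorem PowerDecay.intervalIntegrable [SFinite μ] (h : PowerDecay μ g p) {ε : ℝ} (hε : 0 < ε)
    (hp : ∀ x, g x ≠ 0 → ε ≤ (p x + 1).re) {β : ℝ} (hβ : 0 < β) {z : ℝ} (hz : 0 < z) :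
    IntervalIntegrable (fun τ : ℝ => (((z - τ) ^ (β - 1) : ℝ) : ℂ) * powInt μ g p τ) volume 0 z := by
  rw [intervalIntegrable_iff_integrableOn_Ioc_of_le hz.le]
  refine (h.integrable_prod hε hp hβ hz).integral_prod_left.congr (.of_forall fun τ => ?_)
  simp only [Function.uncurry_apply_pair, integral_const_mul, powInt]

/-- Riemann-Liouville integrals of superpositions of powers are computed termwise. -/
theorem PowerDecay.rlIntegral_eq [SFinite μ] (h : PowerDecay μ g p) {ε : ℝ} (hε : 0 < ε)
    (hp : ∀ x, g x ≠ 0 → ε ≤ (p x + 1).re) {β : ℝ} (hβ : 0 < β) {z : ℝ} (hz : 0 < z) :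
    rlIntegral β (powInt μ g p) z =
      powInt μ (fun x => g x * (Complex.Gamma (p x + 1) / Complex.Gamma (p x + 1 + β)))
        (fun x => p x + β) z := by
  have h1 := integral_integral_swap (h.integrable_prod hε hp hβ hz)
  simp only [integral_const_mul] at h1
  rw [rlIntegral, intervalIntegral.integral_of_le hz.le]
  simp only [powInt]
  rw [h1, ← integral_const_mul]
  refine integral_congr_ae (.of_forall fun x => ?_)
  simp only
  by_cases hx : g x = 0
  · simp [hx]
  · have h2 := integral_sub_rpow_mul_cpow (p := p x) (hε.trans_le (hp x hx)) hβ hz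
    have h3 : Complex.Gamma β ≠ 0 := Complex.Gamma_ne_zero_of_re_pos (by simpa)
    simp only [mul_left_comm _ (g x), integral_const_mul]
    rw [← intervalIntegral.integral_of_le hz.le, h2]
    push_cast
    rw [← Complex.Gamma_ofReal]
    field_simp

/-- Iterates `1/Γ(s) = s/Γ(s+1)`, which also holds at the poles because `1/Γ` is `0` there; hence no
restriction on `q`. -/
theorem prod_sub_div_Gamma (N : ℕ) (q : ℂ) :
    (∏ j ∈ Finset.range N, (q - j)) / Complex.Gamma (q + 1) = 1 / Complex.Gamma (q + 1 - N) := by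
  induction N with
  | zero => simp
  | succ N ih =>
    rw [Finset.prod_range_succ, mul_div_right_comm, ih, one_div, one_div, Nat.cast_add,
      Nat.cast_one, show q + 1 - ((N : ℂ) + 1) = q - N by ring,
      Complex.one_div_Gamma_eq_self_mul_one_div_Gamma_add_one (q - N),
      show q - N + 1 = q + 1 - (N : ℂ) by ring, mul_comm]

/-- With `β = N - α`, the falling factorial from `N` derivatives of `z ^ (p+β)` turns `1/Γ(p+1+β)`
into `1/Γ(p+1-α)`. -/
theorem PowerDecay.rlDeriv_eq [SFinite μ] (h : PowerDecay μ g p) {ε : ℝ} (hε : 0 < ε)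
    (hp : ∀ x, g x ≠ 0 → ε ≤ (p x + 1).re) (α : ℝ) {z : ℝ} (hz : 0 < z) :
    rlDeriv α (powInt μ g p) z =
      powInt μ (fun x => g x * (Complex.Gamma (p x + 1) / Complex.Gamma (p x + 1 - α)))
        (fun x => p x - α) z := by
  have hβ : 0 < ((⌊α⌋₊ + 1 : ℕ) : ℝ) - α := by
    have := Nat.lt_floor_add_one α
    push_cast
    linarith
  set β : ℝ := ((⌊α⌋₊ + 1 : ℕ) : ℝ) - α with hβdef
  have h1 := (h.mul_Gamma_div hε hp hβ).add_exponent (β : ℂ)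
  have h2 : rlIntegral β (powInt μ g p) =ᶠ[𝓝 z]
      powInt μ (fun x => g x * (Complex.Gamma (p x + 1) / Complex.Gamma (p x + 1 + β)))
        (fun x => p x + β) := by
    filter_upwards [Ioi_mem_nhds hz] with w hw using h.rlIntegral_eq hε hp hβ hw
  rw [rlDeriv, ← hβdef, h2.iteratedDeriv_eq, h1.iteratedDeriv_eq _ hz]
  have hβc : (β : ℂ) = ((⌊α⌋₊ + 1 : ℕ) : ℂ) - α := by rw [hβdef]; push_cast; ring
  refine integral_congr_ae (.of_forall fun x => ?_)
  simp only
  have h3 := prod_sub_div_Gamma (⌊α⌋₊ + 1) (p x + β)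
  have e1 : p x + β + 1 = p x + 1 + β := by ring
  have e2 : p x + 1 + β - ((⌊α⌋₊ + 1 : ℕ) : ℂ) = p x + 1 - α := by rw [hβc]; ring
  have e3 : p x + β - ((⌊α⌋₊ + 1 : ℕ) : ℂ) = p x - α := by rw [hβc]; ring
  rw [e1, e2] at h3
  rw [e3, div_eq_mul_one_div (Complex.Gamma (p x + 1)) (Complex.Gamma (p x + 1 - α)), ← h3]
  ring

theorem PowerDecay.hasRLDeriv [SFinite μ] (h : PowerDecay μ g p) {ε : ℝ} (hε : 0 < ε)
    (hp : ∀ x, g x ≠ 0 → ε ≤ (p x + 1).re) (α : ℝ) : HasRLDeriv α (powInt μ g p) := by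
  have hβ : 0 < ((⌊α⌋₊ + 1 : ℕ) : ℝ) - α := by
    have := Nat.lt_floor_add_one α
    push_cast
    linarith
  refine ⟨fun z hz => h.intervalIntegrable hε hp hβ hz, ?_⟩
  refine (((h.mul_Gamma_div hε hp hβ).add_exponent _).contDiffOn _).congr
    fun z hz => h.rlIntegral_eq hε hp hβ hz

theorem eulerCharPoly_eval (n : ℕ) (a : ℕ → ℝ) (q : ℂ) :
    (eulerCharPoly n a).eval q =
      ∑ k ∈ Finset.range (n + 1), (a k : ℂ) * ∏ j ∈ Finset.range k, (q - j) := by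
  simp [eulerCharPoly, Polynomial.eval_finsetSum, Polynomial.eval_prod]

/-- A superposition of powers solves the Euler equation as soon as the termwise computed sides of
the equation agree. -/
theorem PowerDecay.isEulerSolution [SFinite μ] (h : PowerDecay μ g p) {ε : ℝ} (hε : 0 < ε)
    (hp : ∀ x, g x ≠ 0 → ε ≤ (p x + 1).re) (α : ℝ) (m n : ℕ) (a : ℕ → ℝ)
    (heq : ∀ z : ℝ, 0 < z →
      powInt μ (fun x => g x * (Complex.Gamma (p x + 1) / Complex.Gamma (p x + 1 - α)))
        (fun x => p x - α) z =
      powInt μ (fun x => g x * (eulerCharPoly n a).eval (p x)) (fun x => p x + m) z) :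
    IsEulerSolution α m n a (powInt μ g p) := by
  refine ⟨h.contDiffOn n, h.hasRLDeriv hε hp α, fun z hz => ?_⟩
  rw [h.rlDeriv_eq hε hp α hz, heq z hz]
  have hz' : (z : ℂ) ≠ 0 := by exact_mod_cast hz.ne'
  have h1 : ∀ k, (a k : ℂ) * (z : ℂ) ^ k * iteratedDeriv k (powInt μ g p) z =
      ∫ x, (a k : ℂ) * ((g x * ∏ j ∈ Finset.range k, (p x - j)) * (z : ℂ) ^ p x) ∂μ := fun k => by
    rw [h.iteratedDeriv_eq k hz, powInt, integral_const_mul, mul_assoc, ← integral_const_mul]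
    congr 2
    ext x
    rw [Complex.cpow_sub _ _ hz', Complex.cpow_natCast]
    have := pow_ne_zero k hz'
    field_simp
  simp only [h1]
  rw [← integral_finsetSum _ fun k _ => ((h.mul_prod k).integrable hz).const_mul _,
    ← integral_const_mul, powInt]
  refine integral_congr_ae (.of_forall fun x => ?_)
  simp only
  rw [eulerCharPoly_eval, Complex.cpow_add _ _ hz', Complex.cpow_natCast, Finset.mul_sum,
    Finset.mul_sum, Finset.sum_mul]
  refine Finset.sum_congr rfl fun k _ => ?_
  ring

/-- The fractional integral at `z` only sees `(0, z]` and derivatives are local, so values at `z ≤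
0` are irrelevant. -/
theorem IsEulerSolution.congr {α : ℝ} {m n : ℕ} {a : ℕ → ℝ} {y₁ y₂ : ℝ → ℂ}
    (h : IsEulerSolution α m n a y₁) (hy : ∀ z, 0 < z → y₂ z = y₁ z) :
    IsEulerSolution α m n a y₂ := by
  obtain ⟨h1, ⟨h2, h3⟩, h4⟩ := h
  have hrl : ∀ β z : ℝ, 0 < z → rlIntegral β y₂ z = rlIntegral β y₁ z := fun β z hz => by
    rw [rlIntegral, rlIntegral, intervalIntegral.integral_of_le hz.le,
      intervalIntegral.integral_of_le hz.le]
    congr 1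
    exact setIntegral_congr_fun measurableSet_Ioc fun τ hτ => by simp only [hy τ hτ.1]
  refine ⟨h1.congr hy, ⟨fun z hz => (h2 z hz).congr fun τ hτ => ?_, h3.congr fun z hz => hrl _ z hz⟩,
    fun z hz => ?_⟩
  · rw [uIoc_of_le hz.le] at hτ
    simp only [hy τ hτ.1]
  · have e1 : rlIntegral ((⌊α⌋₊ + 1 : ℕ) - α) y₂ =ᶠ[𝓝 z] rlIntegral ((⌊α⌋₊ + 1 : ℕ) - α) y₁ := by
      filter_upwards [Ioi_mem_nhds hz] with w hw using hrl _ w hw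
    have e2 : y₂ =ᶠ[𝓝 z] y₁ := by
      filter_upwards [Ioi_mem_nhds hz] with w hw using hy w hw
    have h5 := h4 z hz
    rw [rlDeriv] at h5 ⊢
    rw [e1.iteratedDeriv_eq, h5]
    simp only [e2.iteratedDeriv_eq]

theorem IsEulerSolution.zero (α : ℝ) (m n : ℕ) (a : ℕ → ℝ) :
    IsEulerSolution α m n a fun _ => 0 := by
  have h : ∀ β, rlIntegral β (fun _ => 0) = fun _ => 0 := fun β => by ext z; simp [rlIntegral]
  refine ⟨contDiffOn_const, ⟨fun z _ => by simp, ?_⟩, fun z _ => ?_⟩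
  · rw [h]; exact contDiffOn_const
  · rw [rlDeriv, h]; simp

theorem IsEulerSolution.add {α : ℝ} {m n : ℕ} {a : ℕ → ℝ} {y₁ y₂ : ℝ → ℂ}
    (h₁ : IsEulerSolution α m n a y₁) (h₂ : IsEulerSolution α m n a y₂) :
    IsEulerSolution α m n a fun z => y₁ z + y₂ z := by
  obtain ⟨h1, ⟨h2, h3⟩, h4⟩ := h₁
  obtain ⟨k1, ⟨k2, k3⟩, k4⟩ := h₂
  have hrl : ∀ z : ℝ, 0 < z → rlIntegral ((⌊α⌋₊ + 1 : ℕ) - α) (fun z => y₁ z + y₂ z) z =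
      rlIntegral ((⌊α⌋₊ + 1 : ℕ) - α) y₁ z + rlIntegral ((⌊α⌋₊ + 1 : ℕ) - α) y₂ z := fun z hz => by
    simp only [rlIntegral, mul_add]
    rw [intervalIntegral.integral_add (h2 z hz) (k2 z hz), mul_add]
  refine ⟨h1.add k1, ⟨fun z hz => ?_, (h3.add k3).congr hrl⟩, fun z hz => ?_⟩
  · simpa only [mul_add] using (h2 z hz).add (k2 z hz)
  · have e1 : rlIntegral ((⌊α⌋₊ + 1 : ℕ) - α) (fun z => y₁ z + y₂ z) =ᶠ[𝓝 z] fun z =>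
        rlIntegral ((⌊α⌋₊ + 1 : ℕ) - α) y₁ z + rlIntegral ((⌊α⌋₊ + 1 : ℕ) - α) y₂ z := by
      filter_upwards [Ioi_mem_nhds hz] with w hw using hrl w hw
    have hn := Ioi_mem_nhds hz
    have h5 := h4 z hz
    have k5 := k4 z hz
    rw [rlDeriv] at h5 k5 ⊢
    rw [e1.iteratedDeriv_eq, iteratedDeriv_fun_add (h3.contDiffAt hn) (k3.contDiffAt hn), h5, k5,
      ← mul_add, ← Finset.sum_add_distrib]
    congr 1
    refine Finset.sum_congr rfl fun k hk => ?_
    have hk' : ((k : ℕ) : WithTop ℕ∞) ≤ n := by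
      exact_mod_cast Finset.mem_range_succ_iff.1 hk
    rw [iteratedDeriv_fun_add ((h1.contDiffAt hn).of_le hk') ((k1.contDiffAt hn).of_le hk')]
    ring

theorem IsEulerSolution.sum {α : ℝ} {m n : ℕ} {a : ℕ → ℝ} {ι : Type*} (t : Finset ι)
    {y : ι → ℝ → ℂ} (h : ∀ i ∈ t, IsEulerSolution α m n a (y i)) :
    IsEulerSolution α m n a fun z => ∑ i ∈ t, y i z := by
  classical
  induction t using Finset.induction_on with
  | empty => simpa using IsEulerSolution.zero α m n a
  | insert i t hi ih =>
    simp only [Finset.sum_insert hi]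
    exact (h i (by simp)).add (ih fun j hj => h j (by simp [hj]))

end RiemannLiouville

/-! ### The recursion of step `σ` for the Gamma products -/

section GammaProducts

/-- The product of the Gamma functions attached to the roots `s` and to the factor `z ^ m`. -/
noncomputable def gammaProd (σ : ℝ) (m : ℕ) {n : ℕ} (s : Fin n → ℂ) (q : ℂ) : ℂ :=
  (∏ i, Complex.Gamma ((q - s i) / σ)) * ∏ i : Fin m, Complex.Gamma ((q + ((i : ℕ) + 1)) / σ)

theorem prod_add_div_Gamma (m : ℕ) (u : ℂ) :
    (∏ i : Fin m, (u + (i : ℕ))) / Complex.Gamma (u + m) = 1 / Complex.Gamma u := by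
  induction m with
  | zero => simp
  | succ m ih =>
    rw [Fin.prod_univ_castSucc, ← ih, mul_div_assoc]
    simp only [Fin.val_castSucc, Fin.val_last]
    rw [div_eq_mul_inv (∏ i : Fin m, (u + (i : ℕ))),
      Complex.one_div_Gamma_eq_self_mul_one_div_Gamma_add_one (u + m), Nat.cast_add, Nat.cast_one,
      ← add_assoc, div_eq_mul_inv]

/-- The falling factorial of length `k` is monic of degree `k`, so the leading coefficient is `a n`;
over `ℂ` the polynomial splits. -/
theorem eulerCharPoly_eval_eq_prod {n : ℕ} {a : ℕ → ℝ} (han : 0 < a n) {s : Fin n → ℂ}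
    (hs : (eulerCharPoly n a).roots = Finset.univ.val.map s) (q : ℂ) :
    (eulerCharPoly n a).eval q = a n * ∏ i, (q - s i) := by
  have hdeg : ∀ k : ℕ, (∏ j ∈ Finset.range k,
      (Polynomial.X - Polynomial.C (j : ℂ))).natDegree = k := fun k => by
    rw [Polynomial.natDegree_prod_of_monic _ _ fun j _ => Polynomial.monic_X_sub_C _]
    simp only [Polynomial.natDegree_X_sub_C, Finset.sum_const, Finset.card_range, smul_eq_mul,
      mul_one]
  have hmon : ∀ k : ℕ, (∏ j ∈ Finset.range k, (Polynomial.X - Polynomial.C (j : ℂ))).Monic :=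
    fun k => Polynomial.monic_prod_of_monic _ _ fun j _ => Polynomial.monic_X_sub_C _
  have hcoeff : (eulerCharPoly n a).coeff n = a n := by
    rw [eulerCharPoly, Finset.sum_range_succ, Polynomial.coeff_add, Polynomial.coeff_C_mul,
      Polynomial.finsetSum_coeff, Finset.sum_eq_zero, zero_add]
    · have := hmon n
      rw [Polynomial.Monic, Polynomial.leadingCoeff, hdeg] at this
      rw [this, mul_one]
    · intro k hk
      rw [Polynomial.coeff_C_mul, Polynomial.coeff_eq_zero_of_natDegree_lt, mul_zero]
      rw [hdeg]
      exact Finset.mem_range.1 hk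
  have hle : (eulerCharPoly n a).natDegree ≤ n := by
    refine Polynomial.natDegree_sum_le_of_forall_le _ _ fun k hk => ?_
    refine (Polynomial.natDegree_C_mul_le _ _).trans ?_
    rw [hdeg]
    exact Finset.mem_range_succ_iff.1 hk
  have hne : (eulerCharPoly n a).coeff n ≠ 0 := by
    rw [hcoeff]; exact_mod_cast han.ne'
  have hlead : (eulerCharPoly n a).leadingCoeff = a n := by
    rw [Polynomial.leadingCoeff, le_antisymm hle (Polynomial.le_natDegree_of_ne_zero hne), hcoeff]
  have := (IsAlgClosed.splits (eulerCharPoly n a)).eq_prod_roots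
  conv_lhs => rw [this]
  rw [hlead, hs, Polynomial.eval_mul, Polynomial.eval_C, Multiset.map_map]
  congr 1
  rw [← Finset.prod_eq_multiset_prod, Polynomial.eval_prod]
  simp

/-- The functional equation in every factor. Only the argument `0` has to be excluded: at the other
poles both sides take the default value `0`. -/
theorem gammaProd_add {σ : ℝ} (hσ : σ ≠ 0) (m : ℕ) {n : ℕ} {s : Fin n → ℂ} {q : ℂ}
    (h1 : ∀ i, (q - s i) / σ ≠ 0) (h2 : ∀ i : Fin m, (q + ((i : ℕ) + 1)) / σ ≠ 0) :
    gammaProd σ m s (q + σ) =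
      ((∏ i, (q - s i) / σ) * ∏ i : Fin m, (q + ((i : ℕ) + 1)) / σ) * gammaProd σ m s q := by
  have hσ' : (σ : ℂ) ≠ 0 := by exact_mod_cast hσ
  have e1 : ∀ i, Complex.Gamma ((q + σ - s i) / σ) =
      (q - s i) / σ * Complex.Gamma ((q - s i) / σ) := fun i => by
    rw [← Complex.Gamma_add_one _ (h1 i)]
    congr 1
    field_simp
    ring
  have e2 : ∀ i : Fin m, Complex.Gamma ((q + σ + ((i : ℕ) + 1)) / σ) =
      (q + ((i : ℕ) + 1)) / σ * Complex.Gamma ((q + ((i : ℕ) + 1)) / σ) := fun i => by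
    rw [← Complex.Gamma_add_one _ (h2 i)]
    congr 1
    field_simp
    ring
  simp only [gammaProd, e1, e2, Finset.prod_mul_distrib]
  ring

/-- The recursion satisfied by the coefficients of the solutions. -/
theorem gammaProd_add_div_Gamma {σ : ℝ} (hσ : σ ≠ 0) (m : ℕ) {n : ℕ} {a : ℕ → ℝ} (han : 0 < a n)
    {s : Fin n → ℂ} (hs : (eulerCharPoly n a).roots = Finset.univ.val.map s) {q : ℂ}
    (h1 : ∀ i, (q - s i) / σ ≠ 0) (h2 : ∀ i : Fin m, (q + ((i : ℕ) + 1)) / σ ≠ 0) :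
    gammaProd σ m s (q + σ) * (a n * σ ^ (m + n) : ℝ) / Complex.Gamma (q + 1 + m) =
      gammaProd σ m s q / Complex.Gamma (q + 1) * (eulerCharPoly n a).eval q := by
  have hσ' : (σ : ℂ) ≠ 0 := by exact_mod_cast hσ
  have e3 := prod_add_div_Gamma m (q + 1)
  have e4 : ∏ i : Fin m, (q + ((i : ℕ) + 1)) = ∏ i : Fin m, (q + 1 + (i : ℕ)) :=
    Finset.prod_congr rfl fun i _ => by ring
  rw [eulerCharPoly_eval_eq_prod han hs, gammaProd_add hσ m h1 h2]
  simp only [Finset.prod_div_distrib, Finset.prod_const, Finset.card_univ, Fintype.card_fin]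
  rw [e4, div_eq_mul_one_div _ (Complex.Gamma (q + 1)), ← e3]
  push_cast
  rw [pow_add]
  field_simp

end GammaProducts

/-! ### Shifting a vertical contour -/

section ContourShift

theorem integrable_exp_neg_mul_abs {δ : ℝ} (hδ : 0 < δ) :
    Integrable fun t : ℝ => Real.exp (-(δ * |t|)) := by
  rw [← integrableOn_univ, ← Iic_union_Ioi (a := (0 : ℝ))]
  refine IntegrableOn.union ?_ ?_
  · refine (integrableOn_exp_mul_Iic hδ 0).congr_fun (fun t ht => ?_) measurableSet_Iic
    simp only [abs_of_nonpos (mem_Iic.1 ht), mul_neg, neg_neg]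
  · refine (integrableOn_exp_mul_Ioi (neg_lt_zero.2 hδ) 0).congr_fun (fun t ht => ?_)
      measurableSet_Ioi
    simp only [abs_of_pos (mem_Ioi.1 ht), neg_mul]

/-- Cauchy's theorem on the rectangle of height `2T`; the horizontal sides vanish as `T → ∞`. -/
theorem integral_vertical_eq {f : ℂ → ℂ} {x₁ x₂ δ M : ℝ} (hδ : 0 < δ) (h12 : x₁ ≤ x₂)
    (hf : ∀ s : ℂ, x₁ ≤ s.re → s.re ≤ x₂ → DifferentiableAt ℂ f s)
    (hM : ∀ s : ℂ, x₁ ≤ s.re → s.re ≤ x₂ → ‖f s‖ ≤ M * Real.exp (-(δ * |s.im|))) :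
    ∫ t : ℝ, f (x₁ + t * Complex.I) = ∫ t : ℝ, f (x₂ + t * Complex.I) := by
  have hint : ∀ x : ℝ, x₁ ≤ x → x ≤ x₂ → Integrable fun t : ℝ => f (x + t * Complex.I) := by
    intro x hx1 hx2
    refine ((integrable_exp_neg_mul_abs hδ).const_mul M).mono' ?_ (.of_forall fun t => ?_)
    · refine Continuous.aestronglyMeasurable (continuous_iff_continuousAt.2 fun t => ?_)
      refine ContinuousAt.comp (f := fun t : ℝ => (x : ℂ) + t * Complex.I) (g := f)
        (hf _ (by simpa) (by simpa)).continuousAt (by fun_prop)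
    · simpa using hM (x + t * Complex.I) (by simpa) (by simpa)
  have hlim : ∀ x : ℝ, x₁ ≤ x → x ≤ x₂ → Tendsto
      (fun T : ℝ => ∫ t in (-T)..T, f (x + t * Complex.I)) atTop
      (𝓝 (∫ t : ℝ, f (x + t * Complex.I))) := fun x hx1 hx2 =>
    intervalIntegral_tendsto_integral (hint x hx1 hx2) tendsto_neg_atTop_atBot tendsto_id
  have hhor : ∀ c : ℝ, (c = 1 ∨ c = -1) → Tendsto
      (fun T : ℝ => ∫ x in x₁..x₂, f (x + ((c * T : ℝ) : ℂ) * Complex.I)) atTop (𝓝 0) := by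
    intro c hc
    have hcabs : |c| = 1 := by rcases hc with rfl | rfl <;> simp
    have h0 : Tendsto (fun T : ℝ => M * Real.exp (-(δ * |T|)) * |x₂ - x₁|) atTop (𝓝 0) := by
      have h1 : Tendsto (fun T : ℝ => Real.exp (-(δ * |T|))) atTop (𝓝 0) :=
        Real.tendsto_exp_neg_atTop_nhds_zero.comp
          (tendsto_abs_atTop_atTop.const_mul_atTop hδ)
      simpa using (h1.const_mul M).mul_const |x₂ - x₁|
    refine squeeze_zero_norm (fun T => ?_) h0
    refine intervalIntegral.norm_integral_le_of_norm_le_const fun x hx => ?_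
    rw [uIoc_of_le h12] at hx
    have := hM (x + ((c * T : ℝ) : ℂ) * Complex.I) (by simpa using hx.1.le) (by simpa using hx.2)
    simpa [abs_mul, hcabs] using this
  have hrect : ∀ T : ℝ,
      (∫ t in (-T)..T, f (x₂ + t * Complex.I)) - ∫ t in (-T)..T, f (x₁ + t * Complex.I) =
      Complex.I * ((∫ x in x₁..x₂, f (x + ((-1 * T : ℝ) : ℂ) * Complex.I)) -
        ∫ x in x₁..x₂, f (x + ((1 * T : ℝ) : ℂ) * Complex.I)) := fun T => by
    have h := Complex.integral_boundary_rect_eq_zero_of_differentiableOn f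
      (x₁ + ((-T : ℝ) : ℂ) * Complex.I) (x₂ + (T : ℂ) * Complex.I) (fun s hs => by
        have h1 := hs.1
        simp only [mem_preimage, Complex.add_re, Complex.ofReal_re, Complex.mul_re, Complex.I_re,
          mul_zero, Complex.ofReal_im, Complex.I_im, sub_self, add_zero, mul_one,
          uIcc_of_le h12] at h1
        exact (hf s h1.1 h1.2).differentiableWithinAt)
    simp only [Complex.add_re, Complex.ofReal_re, Complex.mul_re, Complex.I_re,
          mul_zero, Complex.ofReal_im, Complex.I_im, sub_self, add_zero, mul_one,
          Complex.add_im, Complex.mul_im, zero_add, smul_eq_mul] at h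
    simp only [neg_mul, one_mul]
    linear_combination (-Complex.I) * h + ((∫ t in (-T)..T, f (x₂ + t * Complex.I)) -
      ∫ t in (-T)..T, f (x₁ + t * Complex.I)) * Complex.I_sq
  have h1 := (hlim x₂ h12 le_rfl).sub (hlim x₁ le_rfl h12)
  have h2 := ((hhor (-1) (.inr rfl)).sub (hhor 1 (.inl rfl))).const_mul Complex.I
  simp only [hrect] at h1
  have h3 := tendsto_nhds_unique h1 h2
  rw [sub_zero, mul_zero, sub_eq_zero] at h3
  exact h3.symm

end ContourShift

/-! ### The Mellin–Barnes solution, case `α < n` -/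

section MellinBarnes

/-- The integrand of the Mellin-Barnes integral, without the power of the argument, and with a
shifted parameter in the denominator. -/
noncomputable def barnesKernel (σ : ℝ) (m : ℕ) {n : ℕ} (s : Fin n → ℂ) (b : ℝ) (w : ℂ) : ℂ :=
  gammaProd σ m s (-(σ * w)) / Complex.Gamma (b - σ * w)

/-- All poles of the numerator of the Mellin-Barnes kernel are on the right of `Re w = x`. -/
def LeftOfPoles (σ : ℝ) (m : ℕ) {n : ℕ} (s : Fin n → ℂ) (x : ℝ) : Prop :=
  (∀ i, x < (-(s i) / (σ : ℂ)).re) ∧ ∀ i : Fin m, x < ((i : ℕ) + 1) / σ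

variable {σ : ℝ} {m n : ℕ} {s : Fin n → ℂ}

theorem LeftOfPoles.mono {x x' : ℝ} (h : LeftOfPoles σ m s x) (hx : x' ≤ x) :
    LeftOfPoles σ m s x' :=
  ⟨fun i => hx.trans_lt (h.1 i), fun i => hx.trans_lt (h.2 i)⟩

theorem exists_leftOfPoles (σ : ℝ) (m : ℕ) {n : ℕ} (s : Fin n → ℂ) :
    ∃ x, LeftOfPoles σ m s x := by
  obtain ⟨x₁, h₁⟩ := (finite_range fun i => (-(s i) / (σ : ℂ)).re).bddBelow
  obtain ⟨x₂, h₂⟩ := (finite_range fun i : Fin m => (((i : ℕ) : ℝ) + 1) / σ).bddBelow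
  refine ⟨min x₁ x₂ - 1, fun i => ?_, fun i => ?_⟩
  · have := h₁ (mem_range_self i)
    linarith [min_le_left x₁ x₂]
  · have := h₂ (mem_range_self i)
    linarith [min_le_right x₁ x₂]

theorem gammaProd_neg_mul (hσ : 0 < σ) (w : ℂ) :
    gammaProd σ m s (-(σ * w)) = (∏ i, Complex.Gamma (-(s i) / σ - w)) *
      ∏ i : Fin m, Complex.Gamma (((((i : ℕ) + 1 : ℝ) / σ : ℝ) : ℂ) - w) := by
  have hσ' : (σ : ℂ) ≠ 0 := by exact_mod_cast hσ.ne'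
  rw [gammaProd]
  congr 1
  · refine Finset.prod_congr rfl fun i _ => ?_
    congr 1
    field_simp
    ring
  · refine Finset.prod_congr rfl fun i _ => ?_
    congr 1
    push_cast
    field_simp
    ring

theorem exists_norm_prod_Gamma_sub_le {ι : Type*} [Fintype ι] (B : ι → ℂ) (x₁ : ℝ) {x₂ : ℝ}
    (hB : ∀ i, x₂ < (B i).re) {η : ℝ} (hη : 0 < η) (hη' : η ≤ Real.pi / 2) :
    ∃ M, 0 ≤ M ∧ ∀ w : ℂ, x₁ ≤ w.re → w.re ≤ x₂ → ‖∏ i, Complex.Gamma (B i - w)‖ ≤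
      M * Real.exp (-(Fintype.card ι * (Real.pi / 2 - η) * |w.im|)) := by
  have h : ∀ i, ∃ M, 0 ≤ M ∧ ∀ w : ℂ, x₁ ≤ w.re → w.re ≤ x₂ → ‖Complex.Gamma (B i - w)‖ ≤
      M * Real.exp (-((Real.pi / 2 - η) * |w.im|)) := fun i => by
    obtain ⟨M, hM0, hM⟩ := exists_norm_Gamma_le (sub_pos.2 (hB i)) ((B i).re - x₁) hη
    -- The extra factor compensates the shift of the height by `Im (B i)`.
    refine ⟨M * Real.exp ((Real.pi / 2 - η) * |(B i).im|), by positivity, fun w h1 h2 => ?_⟩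
    refine (hM (B i - w) (by rw [Complex.sub_re]; linarith)
      (by rw [Complex.sub_re]; linarith)).trans ?_
    rw [mul_assoc, ← Real.exp_add, Complex.sub_im]
    refine mul_le_mul_of_nonneg_left (Real.exp_le_exp.2 ?_) hM0
    have h3 : |w.im| - |(B i).im| ≤ |(B i).im - w.im| := by
      rw [abs_sub_comm]; exact abs_sub_abs_le_abs_sub _ _
    nlinarith
  choose M hM0 hM using h
  refine ⟨∏ i, M i, Finset.prod_nonneg fun i _ => hM0 i, fun w h1 h2 => ?_⟩
  rw [norm_prod]
  refine (Finset.prod_le_prod (fun i _ => norm_nonneg _) fun i _ => hM i w h1 h2).trans_eq ?_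
  rw [Finset.prod_mul_distrib, Finset.prod_const, Finset.card_univ, ← Real.exp_nat_mul]
  congr 2
  ring

/-- The numerator decays at rate `(m+n)π/2`, the reciprocal of the denominator grows at rate `σπ/2`,
each up to a small loss. -/
theorem exists_norm_barnesKernel_le (hσ : 0 < σ) (hlt : σ < m + n) (b x₁ : ℝ) {x₂ : ℝ}
    (hx : LeftOfPoles σ m s x₂) :
    ∃ δ M, 0 < δ ∧ 0 ≤ M ∧ ∀ w : ℂ, x₁ ≤ w.re → w.re ≤ x₂ →
      ‖barnesKernel σ m s b w‖ ≤ M * Real.exp (-(δ * |w.im|)) := by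
  have hD : 0 < m + n - σ := by linarith
  have hS : 0 < m + n + σ := by linarith
  -- The total loss `η(m+n+σ)` is then `(m+n-σ)/2`, which leaves the rate `(π-1)/2 * (m+n-σ) > 0`.
  set η := (m + n - σ) / (2 * (m + n + σ)) with hηdef
  have hη : 0 < η := by positivity
  have hη' : η ≤ Real.pi / 2 := by
    have : η ≤ 1 := by
      rw [hηdef, div_le_one (by positivity)]
      linarith
    linarith [Real.pi_gt_three]
  obtain ⟨M₁, hM₁, h₁⟩ := exists_norm_prod_Gamma_sub_le _ x₁ hx.1 hη hη'
  obtain ⟨M₂, hM₂, h₂⟩ := exists_norm_prod_Gamma_sub_le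
    (fun i : Fin m => (((((i : ℕ) + 1 : ℝ) / σ : ℝ) : ℂ))) x₁
    (fun i => by simpa only [Complex.ofReal_re] using hx.2 i) hη hη'
  obtain ⟨M₃, hM₃, h₃⟩ := exists_norm_inv_Gamma_le (b - σ * x₂) (b - σ * x₁) hη
  refine ⟨(Real.pi - 1) / 2 * (m + n - σ), M₁ * M₂ * M₃, ?_, by positivity, fun w hw1 hw2 => ?_⟩
  · have := Real.pi_gt_three
    have : 0 < (Real.pi - 1) / 2 := by linarith
    positivity
  have e1 : ((b : ℂ) - σ * w).re = b - σ * w.re := by simp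
  have e2 : |((b : ℂ) - σ * w).im| = σ * |w.im| := by simp [abs_mul, abs_of_pos hσ]
  have h₃' := h₃ (b - σ * w) (by rw [e1]; gcongr) (by rw [e1]; gcongr)
  rw [e2] at h₃'
  rw [barnesKernel, gammaProd_neg_mul hσ, div_eq_mul_inv, norm_mul, norm_mul]
  refine (mul_le_mul (mul_le_mul (h₁ w hw1 hw2) (h₂ w hw1 hw2) (norm_nonneg _) (by positivity))
    h₃' (norm_nonneg _) (by positivity)).trans_eq ?_
  simp only [Fintype.card_fin]
  have e3 : Real.exp (-((Real.pi - 1) / 2 * (m + n - σ) * |w.im|)) =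
      Real.exp (-(n * (Real.pi / 2 - η) * |w.im|)) * Real.exp (-(m * (Real.pi / 2 - η) * |w.im|)) *
        Real.exp ((Real.pi / 2 + η) * (σ * |w.im|)) := by
    rw [← Real.exp_add, ← Real.exp_add]
    congr 1
    have : η * (m + n + σ) = (m + n - σ) / 2 := by rw [hηdef]; field_simp
    linear_combination (-|w.im|) * this
  rw [e3]
  ring

theorem differentiableAt_barnesKernel (hσ : 0 < σ) (b : ℝ) {w : ℂ}
    (hw : LeftOfPoles σ m s w.re) : DifferentiableAt ℂ (barnesKernel σ m s b) w := by
  have hΓ : ∀ B : ℂ, w.re < B.re → DifferentiableAt ℂ (fun w => Complex.Gamma (B - w)) w := by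
    intro B hB
    refine DifferentiableAt.comp (g := Complex.Gamma) (f := fun w => B - w) w
      (Complex.differentiableAt_Gamma _ fun j h => ?_) (by fun_prop)
    have h' := congrArg Complex.re h
    simp only [Complex.sub_re, Complex.neg_re, Complex.natCast_re] at h'
    have hj : (0 : ℝ) ≤ j := j.cast_nonneg
    linarith
  have e : barnesKernel σ m s b = fun w => (∏ i, Complex.Gamma (-(s i) / σ - w)) *
      (∏ i : Fin m, Complex.Gamma (((((i : ℕ) + 1 : ℝ) / σ : ℝ) : ℂ) - w)) *
      (Complex.Gamma (b - σ * w))⁻¹ := by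
    ext w
    rw [barnesKernel, gammaProd_neg_mul hσ, div_eq_mul_inv]
  rw [e]
  refine DifferentiableAt.mul (DifferentiableAt.mul ?_ ?_) ?_
  · exact DifferentiableAt.fun_finsetProd fun i _ => hΓ _ (hw.1 i)
  · exact DifferentiableAt.fun_finsetProd fun i _ => hΓ _ (by
      simpa only [Complex.ofReal_re] using hw.2 i)
  · exact (Complex.differentiable_one_div_Gamma.comp (f := fun w : ℂ => (b : ℂ) - σ * w)
      (by fun_prop)).differentiableAt

theorem exists_norm_barnesKernel_mul_cpow_le (hσ : 0 < σ) (hlt : σ < m + n) (b x₁ : ℝ) {x₂ : ℝ}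
    (hx : LeftOfPoles σ m s x₂) {x : ℝ} (hx0 : 0 < x) :
    ∃ δ M, 0 < δ ∧ 0 ≤ M ∧ ∀ w : ℂ, x₁ ≤ w.re → w.re ≤ x₂ →
      ‖barnesKernel σ m s b w * (x : ℂ) ^ w‖ ≤ M * Real.exp (-(δ * |w.im|)) := by
  obtain ⟨δ, M, hδ, hM0, hM⟩ := exists_norm_barnesKernel_le hσ hlt b x₁ hx
  refine ⟨δ, M * (x ^ x₁ + x ^ x₂), hδ, by positivity, fun w h1 h2 => ?_⟩
  rw [norm_mul, Complex.norm_cpow_eq_rpow_re_of_pos hx0]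
  have h3 : x ^ w.re ≤ x ^ x₁ + x ^ x₂ := by
    have p1 := Real.rpow_pos_of_pos hx0 x₁
    have p2 := Real.rpow_pos_of_pos hx0 x₂
    rcases le_total 1 x with h | h
    · linarith [Real.rpow_le_rpow_of_exponent_le h h2]
    · linarith [Real.rpow_le_rpow_of_exponent_ge hx0 h h1]
  calc _ ≤ M * Real.exp (-(δ * |w.im|)) * (x ^ x₁ + x ^ x₂) :=
        mul_le_mul (hM w h1 h2) h3 (Real.rpow_nonneg hx0.le _) (by positivity)
    _ = _ := by ring

theorem differentiableAt_barnesKernel_mul_cpow (hσ : 0 < σ) (b : ℝ) {w : ℂ}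
    (hw : LeftOfPoles σ m s w.re) {x : ℝ} (hx0 : 0 < x) :
    DifferentiableAt ℂ (fun w => barnesKernel σ m s b w * (x : ℂ) ^ w) w :=
  (differentiableAt_barnesKernel hσ b hw).mul
    (differentiableAt_id.const_cpow (.inl (by exact_mod_cast hx0.ne')))

theorem continuous_barnesKernel_vertical (hσ : 0 < σ) (b : ℝ) {γ : ℝ}
    (hγ : LeftOfPoles σ m s γ) {x : ℝ} (hx0 : 0 < x) :
    Continuous fun t : ℝ => barnesKernel σ m s b (γ + t * Complex.I) *
      (x : ℂ) ^ (γ + t * Complex.I) :=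
  continuous_iff_continuousAt.2 fun t =>
    ContinuousAt.comp (f := fun t : ℝ => (γ : ℂ) + t * Complex.I)
      (g := fun w => barnesKernel σ m s b w * (x : ℂ) ^ w)
      (differentiableAt_barnesKernel_mul_cpow hσ b (by simpa using hγ) hx0).continuousAt
      (by fun_prop)

theorem integrable_barnesKernel_vertical (hσ : 0 < σ) (hlt : σ < m + n) (b : ℝ) {γ : ℝ}
    (hγ : LeftOfPoles σ m s γ) {x : ℝ} (hx0 : 0 < x) :
    Integrable fun t : ℝ => barnesKernel σ m s b (γ + t * Complex.I) *
      (x : ℂ) ^ (γ + t * Complex.I) := by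
  obtain ⟨δ, M, hδ, hM0, hM⟩ := exists_norm_barnesKernel_mul_cpow_le hσ hlt b γ hγ hx0
  refine ((integrable_exp_neg_mul_abs hδ).const_mul M).mono'
    (continuous_barnesKernel_vertical hσ b hγ hx0).aestronglyMeasurable (.of_forall fun t => ?_)
  simpa using hM (γ + t * Complex.I) (by simp) (by simp)

theorem integral_barnesKernel_eq (hσ : 0 < σ) (hlt : σ < m + n) (b : ℝ) {γ γ' : ℝ}
    (hγ : LeftOfPoles σ m s γ) (hle : γ' ≤ γ) {x : ℝ} (hx0 : 0 < x) :
    ∫ t : ℝ, barnesKernel σ m s b (γ' + t * Complex.I) * (x : ℂ) ^ (γ' + t * Complex.I) =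
      ∫ t : ℝ, barnesKernel σ m s b (γ + t * Complex.I) * (x : ℂ) ^ (γ + t * Complex.I) := by
  obtain ⟨δ, M, hδ, hM0, hM⟩ := exists_norm_barnesKernel_mul_cpow_le hσ hlt b γ' hγ hx0
  exact integral_vertical_eq (f := fun w => barnesKernel σ m s b w * (x : ℂ) ^ w) hδ hle
    (fun w _ h2 => differentiableAt_barnesKernel_mul_cpow hσ b (hγ.mono h2) hx0) hM

theorem ofReal_rpow_neg_div_cpow {z C : ℝ} (hz : 0 < z) (hC : 0 < C) (σ : ℝ) (w : ℂ) :
    ((z ^ (-σ) / C : ℝ) : ℂ) ^ w = (C : ℂ) ^ (-w) * (z : ℂ) ^ (-(σ * w)) := by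
  have hz' := Real.rpow_pos_of_pos hz (-σ)
  rw [Complex.cpow_def_of_ne_zero (by exact_mod_cast (div_pos hz' hC).ne'),
    Complex.cpow_def_of_ne_zero (by exact_mod_cast hC.ne'),
    Complex.cpow_def_of_ne_zero (by exact_mod_cast hz.ne'),
    ← Complex.ofReal_log (div_pos hz' hC).le, ← Complex.ofReal_log hC.le, ← Complex.ofReal_log hz.le,
    Real.log_div hz'.ne' hC.ne', Real.log_rpow hz, ← Complex.exp_add]
  congr 1
  push_cast
  ring

theorem powerDecay_barnesKernel (hσ : 0 < σ) (hlt : σ < m + n) {γ : ℝ}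
    (hγ : LeftOfPoles σ m s γ) {C : ℝ} (hC : 0 < C) (c : ℂ) :
    PowerDecay volume
      (fun t : ℝ => c * (barnesKernel σ m s 1 (γ + t * Complex.I) *
        (C : ℂ) ^ (-(γ + t * Complex.I))))
      (fun t : ℝ => -(σ * (γ + t * Complex.I))) := by
  have hCi : ∀ w : ℂ, (C : ℂ) ^ (-w) = ((C⁻¹ : ℝ) : ℂ) ^ w := fun w => by
    -- The case `z = 1`, `σ = 0` reads `(1/C)^w = C^(-w)`.
    have := ofReal_rpow_neg_div_cpow zero_lt_one hC 0 w
    simpa using this.symm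
  simp only [hCi]
  refine ⟨((continuous_barnesKernel_vertical hσ 1 hγ (inv_pos.2 hC)).const_mul c).measurable,
    by fun_prop, fun k z hz => ?_⟩
  obtain ⟨δ, M, hδ, hM0, hM⟩ :=
    exists_norm_barnesKernel_mul_cpow_le hσ hlt 1 γ hγ (inv_pos.2 hC)
  -- The exponent has norm at most `σ(|γ|+|t|)`, so this rate spends only half of the decay `δ` on
  -- the polynomial factor.
  have hη : 0 < δ / (2 * σ) := by positivity
  have hre : ∀ t : ℝ, (-((σ : ℂ) * (γ + t * Complex.I))).re = -(σ * γ) := fun t => by simp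
  have hcont := (continuous_barnesKernel_vertical hσ 1 hγ (inv_pos.2 hC)).const_mul c
  simp only [hre]
  refine ((integrable_exp_neg_mul_abs (half_pos hδ)).const_mul
    (‖c‖ * M * ((k.factorial / (δ / (2 * σ)) ^ k * Real.exp (δ / (2 * σ))) *
      Real.exp (δ / 2 * |γ|)) * z ^ (-(σ * γ)))).mono'
    (Continuous.aestronglyMeasurable (by fun_prop)) (.of_forall fun t => ?_)
  have h1 := hM (γ + t * Complex.I) (by simp) (by simp)
  simp only [Complex.add_im, Complex.ofReal_im, Complex.mul_im, Complex.ofReal_re, Complex.I_im,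
    mul_one, Complex.I_re, mul_zero, add_zero, zero_add] at h1
  have h2 := one_add_pow_le_exp hη k (norm_nonneg (-((σ : ℂ) * (γ + t * Complex.I))))
  have h3 : δ / (2 * σ) * ‖-((σ : ℂ) * (γ + t * Complex.I))‖ ≤ δ / 2 * |γ| + δ / 2 * |t| := by
    rw [norm_neg, norm_mul, Complex.norm_real, Real.norm_of_nonneg hσ.le]
    have h4 : ‖(γ : ℂ) + t * Complex.I‖ ≤ |γ| + |t| := by
      simpa using norm_add_le (γ : ℂ) (t * Complex.I)
    calc δ / (2 * σ) * (σ * ‖(γ : ℂ) + t * Complex.I‖) = δ / 2 * ‖(γ : ℂ) + t * Complex.I‖ := by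
          field_simp
      _ ≤ δ / 2 * (|γ| + |t|) := by gcongr
      _ = _ := by ring
  have h5 : 0 < z ^ (-(σ * γ)) := Real.rpow_pos_of_pos hz _
  rw [Real.norm_of_nonneg (by positivity), norm_mul]
  have h6 : Real.exp (-(δ / 2 * |t|)) = Real.exp (-(δ * |t|)) * Real.exp (δ / 2 * |t|) := by
    rw [← Real.exp_add]; congr 1; ring
  calc _ ≤ ‖c‖ * (M * Real.exp (-(δ * |t|))) *
        ((k.factorial / (δ / (2 * σ)) ^ k * Real.exp (δ / (2 * σ))) *
          Real.exp (δ / 2 * |γ| + δ / 2 * |t|)) * z ^ (-(σ * γ)) := by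
        refine mul_le_mul_of_nonneg_right (mul_le_mul ?_ (h2.trans ?_) (by positivity)
          (by positivity)) h5.le
        · exact mul_le_mul_of_nonneg_left h1 (norm_nonneg _)
        · gcongr
    _ = _ := by rw [h6, Real.exp_add]; ring

/-- The recursion at `q = -σw`. The parameter `1 - α` is the one that `D^α` leaves in the
denominator. -/
theorem barnesKernel_sub_one (hσ : 0 < σ) {α : ℝ} (hα : σ = α + m) {a : ℕ → ℝ} (han : 0 < a n)
    (hs : (eulerCharPoly n a).roots = Finset.univ.val.map s) {w : ℂ}
    (hw : LeftOfPoles σ m s w.re) :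
    barnesKernel σ m s (1 - α) (w - 1) * (a n * σ ^ (m + n) : ℝ) =
      barnesKernel σ m s 1 w * (eulerCharPoly n a).eval (-(σ * w)) := by
  have hσ' : (σ : ℂ) ≠ 0 := by exact_mod_cast hσ.ne'
  have h := gammaProd_add_div_Gamma hσ.ne' m han hs (q := -(σ * w)) (fun i h0 => ?_) (fun i h0 => ?_)
  · rw [barnesKernel, barnesKernel]
    have e1 : -((σ : ℂ) * (w - 1)) = -(σ * w) + σ := by ring
    have e2 : (((1 - α : ℝ) : ℂ) - σ * (w - 1)) = -(σ * w) + 1 + m := by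
      have : (σ : ℂ) = α + m := by rw [hα]; push_cast; ring
      push_cast
      linear_combination this
    have e3 : (((1 : ℝ) : ℂ) - σ * w) = -(σ * w) + 1 := by push_cast; ring
    rw [e1, e2, e3, ← h]
    ring
  · have h1 : -(s i) / (σ : ℂ) = w := by
      rw [div_eq_zero_iff, or_iff_left hσ'] at h0
      field_simp
      linear_combination h0
    have := hw.1 i
    rw [h1] at this
    exact lt_irrefl _ this
  · have h1 : (((((i : ℕ) + 1 : ℝ) / σ : ℝ) : ℂ)) = w := by
      rw [div_eq_zero_iff, or_iff_left hσ'] at h0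
      push_cast
      field_simp
      linear_combination h0
    have := hw.2 i
    rw [← h1, Complex.ofReal_re] at this
    exact lt_irrefl _ this

/-- `D^α` changes the denominator parameter from `1` to `1 - α`; after a unit shift of the contour
to the left, the integrands of the two sides agree pointwise. -/
theorem isEulerSolution_barnes (hσ : 0 < σ) (hlt : σ < m + n) {α : ℝ} (hα : σ = α + m)
    {a : ℕ → ℝ} (han : 0 < a n) (hs : (eulerCharPoly n a).roots = Finset.univ.val.map s) {γ : ℝ}
    (hγ : LeftOfPoles σ m s γ) (c : ℂ) :
    IsEulerSolution α m n a fun z : ℝ => c * ∫ t : ℝ, barnesKernel σ m s 1 (γ + t * Complex.I) *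
      ((z ^ (-σ) / (a n * σ ^ (m + n)) : ℝ) : ℂ) ^ (γ + t * Complex.I) := by
  have hC : 0 < a n * σ ^ (m + n) := by positivity
  set C := a n * σ ^ (m + n) with hCdef
  -- The exponents `-σw` must have real part above `-1` for integrability at `0`. Moving the contour
  -- to `Re w ≤ 0` ensures this without changing the function.
  have hγ' := hγ.mono (min_le_left γ 0)
  set γ' := min γ 0 with hγ'def
  have hγ'0 : γ' ≤ 0 := min_le_right _ _
  have hre : ∀ t : ℝ, (-((σ : ℂ) * (γ' + t * Complex.I)) + 1).re = -(σ * γ') + 1 := fun t => by simp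
  have hre1 : ∀ t : ℝ, 1 ≤ (-((σ : ℂ) * (γ' + t * Complex.I)) + 1).re := fun t => by
    rw [hre]; nlinarith
  refine IsEulerSolution.congr ((powerDecay_barnesKernel hσ hlt hγ' hC c).isEulerSolution
    zero_lt_one (fun t _ => hre1 t) α m n a fun z hz => ?_) fun z hz => ?_
  · have hz' : (z : ℂ) ≠ 0 := by exact_mod_cast hz.ne'
    have hX : 0 < z ^ (-σ) / C := div_pos (Real.rpow_pos_of_pos hz _) hC
    have hX' : ((z ^ (-σ) / C : ℝ) : ℂ) ≠ 0 := by exact_mod_cast hX.ne'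
    have hshift := integral_barnesKernel_eq hσ hlt (1 - α) hγ' (show γ' - 1 ≤ γ' by linarith) hX
    have hC' : (C : ℂ) ≠ 0 := by exact_mod_cast hC.ne'
    trans c * (z : ℂ) ^ (-(α : ℂ)) * ∫ t : ℝ, barnesKernel σ m s (1 - α) (γ' + t * Complex.I) *
        ((z ^ (-σ) / C : ℝ) : ℂ) ^ (γ' + t * Complex.I)
    · rw [powInt, ← integral_const_mul]
      refine integral_congr_ae (.of_forall fun t => ?_)
      simp only
      have hΓ : Complex.Gamma (-((σ : ℂ) * (γ' + t * Complex.I)) + 1) ≠ 0 :=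
        Complex.Gamma_ne_zero_of_re_pos (by linarith [hre1 t])
      have e1 : (((1 : ℝ) : ℂ) - σ * (γ' + t * Complex.I)) =
        -((σ : ℂ) * (γ' + t * Complex.I)) + 1 := by push_cast; ring
      have e2 : (((1 - α : ℝ) : ℂ) - σ * (γ' + t * Complex.I)) =
        -((σ : ℂ) * (γ' + t * Complex.I)) + 1 - α := by push_cast; ring
      rw [barnesKernel, barnesKernel, e1, e2, ofReal_rpow_neg_div_cpow hz hC,
        sub_eq_add_neg (-((σ : ℂ) * (γ' + t * Complex.I))), Complex.cpow_add _ _ hz']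
      field_simp
    · rw [← hshift, powInt, ← integral_const_mul]
      refine integral_congr_ae (.of_forall fun t => ?_)
      simp only
      have e1 : ((γ' - 1 : ℝ) : ℂ) + t * Complex.I = (γ' + t * Complex.I) - 1 := by push_cast; ring
      have hk := barnesKernel_sub_one hσ hα han hs (w := γ' + t * Complex.I) (by simpa using hγ')
      rw [← hCdef] at hk
      have e2 : ((z ^ (-σ) / C : ℝ) : ℂ) ^ ((γ' : ℂ) + t * Complex.I - 1) =
          (C : ℂ) ^ (-((γ' : ℂ) + t * Complex.I)) * (z : ℂ) ^ (-((σ : ℂ) * (γ' + t * Complex.I))) *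
            (C * (z : ℂ) ^ (σ : ℂ)) := by
        rw [Complex.cpow_sub _ _ hX', Complex.cpow_one, ofReal_rpow_neg_div_cpow hz hC,
          div_eq_mul_inv]
        congr 1
        rw [Real.rpow_neg hz.le, Complex.ofReal_div, Complex.ofReal_inv, Complex.ofReal_cpow hz.le,
          inv_div, div_inv_eq_mul]
      have e3 : (z : ℂ) ^ (-(α : ℂ)) * (z : ℂ) ^ (σ : ℂ) = (z : ℂ) ^ (m : ℂ) := by
        rw [← Complex.cpow_add _ _ hz', hα]
        congr 1
        push_cast
        ring
      rw [e1, e2, Complex.cpow_add _ _ hz', ← e3]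
      linear_combination (c * (C : ℂ) ^ (-((γ' : ℂ) + t * Complex.I)) *
        (z : ℂ) ^ (-((σ : ℂ) * (γ' + t * Complex.I))) *
        (z : ℂ) ^ (-(α : ℂ)) * (z : ℂ) ^ (σ : ℂ)) * hk
  · have hX : 0 < z ^ (-σ) / C := div_pos (Real.rpow_pos_of_pos hz _) hC
    rw [← integral_barnesKernel_eq hσ hlt 1 hγ (min_le_left γ 0) hX, ← hγ'def, powInt,
      ← integral_const_mul]
    refine integral_congr_ae (.of_forall fun t => ?_)
    simp only
    rw [ofReal_rpow_neg_div_cpow hz hC]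
    ring

theorem foxHSeparates_iff (α : ℝ) (m : ℕ) {n : ℕ} (s : Fin n → ℂ) (γ : ℝ) :
    FoxHSeparates (m + n) 0 (hUpper α m) (hLower α m n s) γ ↔ LeftOfPoles (α + m) m s γ := by
  have h : ∀ j : Fin (n + m), (j : ℕ) < m + n := fun j => by omega
  simp only [FoxHSeparates, LeftOfPoles, h, true_imp_iff, Nat.not_lt_zero, IsEmpty.forall_iff,
    implies_true, and_true, Fin.forall_fin_add, hLower, Fin.append_left, Fin.append_right, one_mul,
    Complex.ofReal_re]

theorem foxHIntegrand_eq {α : ℝ} (m : ℕ) {n : ℕ} (hσ : 0 < α + m) (s : Fin n → ℂ) (x w : ℂ) :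
    foxHIntegrand (m + n) 0 (hUpper α m) (hLower α m n s) x w =
      barnesKernel (α + m) m s 1 w * x ^ w := by
  have h1 : Finset.univ.filter (fun j : Fin (n + m) => (j : ℕ) < m + n) = Finset.univ :=
    Finset.filter_true_of_mem fun j _ => by omega
  have h2 : Finset.univ.filter (fun j : Fin (n + m) => m + n ≤ (j : ℕ)) = ∅ :=
    Finset.filter_false_of_mem fun j _ => by omega
  rw [foxHIntegrand, barnesKernel, gammaProd_neg_mul hσ, h1, h2, Fin.prod_univ_add]
  simp [hLower, hUpper, Fin.append_left, Fin.append_right]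

end MellinBarnes

/-! ### The Wright series solution, case `α > n` -/

section WrightSeries

/-- Without summability both sides are `0` by default. -/
theorem integral_count_eq_tsum {X : Type*} [MeasurableSpace X] [MeasurableSingletonClass X]
    [Countable X] (f : X → ℂ) : ∫ x, f x ∂Measure.count = ∑' x, f x := by
  by_cases hf : Integrable f Measure.count
  · rw [integral_countable hf]
    simp [Measure.real]
  · rw [integral_undef hf, tsum_eq_zero_of_not_summable]
    rwa [integrable_count_iff, summable_norm_iff] at hf

/-- By convexity of `log Γ`, its slope on `[x-1, x]`, which is `log (x-1)`, is at most its slope on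
`[x, x+σ]`. -/
theorem Gamma_mul_rpow_le {x σ : ℝ} (hx : 1 < x) (hσ : 0 < σ) :
    Real.Gamma x * (x - 1) ^ σ ≤ Real.Gamma (x + σ) := by
  have h1 : 0 < x - 1 := by linarith
  have h0 : 0 < x := by linarith
  have h := Real.convexOn_log_Gamma.slope_mono_adjacent (x := x - 1) (y := x) (z := x + σ)
    (mem_Ioi.2 h1) (mem_Ioi.2 (by linarith)) (by linarith) (by linarith)
  have hrec : Real.Gamma x = (x - 1) * Real.Gamma (x - 1) := by
    conv_lhs => rw [← sub_add_cancel x 1]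
    rw [Real.Gamma_add_one h1.ne']
  have hΓ1 := Real.Gamma_pos_of_pos h1
  have hΓ0 := Real.Gamma_pos_of_pos h0
  have hΓ2 := Real.Gamma_pos_of_pos (add_pos h0 hσ)
  simp only [Function.comp_apply, sub_sub_cancel, div_one, add_sub_cancel_left] at h
  rw [le_div_iff₀ hσ, hrec, Real.log_mul h1.ne' hΓ1.ne', add_sub_cancel_right] at h
  rw [← Real.log_le_log_iff (by positivity) hΓ2, Real.log_mul hΓ0.ne' (by positivity),
    Real.log_rpow h1, hrec, Real.log_mul h1.ne' hΓ1.ne']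
  linarith

variable {σ : ℝ} {m n : ℕ} {s : Fin n → ℂ}

/-- None of the numerator factors of the coefficients of the series `∑ z ^ (κ + σ r)` is evaluated at a
zero of the corresponding linear factor. -/
def NonResonant (σ : ℝ) (m : ℕ) {n : ℕ} (s : Fin n → ℂ) (κ : ℝ) : Prop :=
  ∀ r : ℕ, (∀ i, (((κ + σ * r : ℝ) : ℂ) - s i) / σ ≠ 0) ∧
    ∀ i : Fin m, (((κ + σ * r : ℝ) : ℂ) + ((i : ℕ) + 1)) / σ ≠ 0

/-- Ratio test. For `q = κ + σr` large, each of the `m+n` new linear factors is at most `2q/σ`, and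
the Gamma quotient is at most `q^(-σ)`; the ratio tends to `0`. -/
theorem summable_gammaProd_div_Gamma (hσ : 0 < σ) (hlt : m + n < σ) {κ : ℝ}
    (hκ : NonResonant σ m s κ) (x : ℂ) :
    Summable fun r : ℕ => gammaProd σ m s ((κ + σ * r : ℝ) : ℂ) /
      Complex.Gamma (((κ + σ * r : ℝ) : ℂ) + 1) * x ^ r := by
  have hq : Tendsto (fun r : ℕ => κ + σ * r) atTop atTop :=
    tendsto_atTop_add_const_left _ _ (tendsto_natCast_atTop_atTop.const_mul_atTop hσ)
  have hlim : Tendsto (fun r : ℕ => (2 / σ) ^ (n + m) * ‖x‖ *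
      (κ + σ * r) ^ (-(σ - (m + n)))) atTop (𝓝 0) := by
    simpa using ((tendsto_rpow_neg_atTop (sub_pos.2 hlt)).comp hq).const_mul
      ((2 / σ) ^ (n + m) * ‖x‖)
  refine summable_of_ratio_norm_eventually_le (r := 1 / 2) (by norm_num) ?_
  filter_upwards [hlim.eventually_le_const (show (0 : ℝ) < 1 / 2 by norm_num),
    hq.eventually_gt_atTop 0, hq.eventually_ge_atTop (∑ i, ‖s i‖), hq.eventually_ge_atTop m]
    with r h1 h2 h3 h4
  have hstep : (((κ + σ * (r + 1 : ℕ) : ℝ)) : ℂ) = ((κ + σ * r : ℝ) : ℂ) + σ := by push_cast; ring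
  rw [hstep, gammaProd_add hσ.ne' m (hκ r).1 (hκ r).2]
  set q : ℝ := κ + σ * r with hqdef
  have f1 : ‖∏ i, ((q : ℂ) - s i) / σ‖ ≤ (2 / σ * q) ^ n := by
    rw [norm_prod]
    refine (Finset.prod_le_prod (g := fun _ => 2 / σ * q) (fun i _ => norm_nonneg _)
      fun i _ => ?_).trans_eq (by simp)
    rw [norm_div, Complex.norm_real, Real.norm_of_nonneg hσ.le, div_mul_eq_mul_div]
    refine div_le_div_of_nonneg_right ((norm_sub_le _ _).trans ?_) hσ.le
    have := Finset.single_le_sum (f := fun i => ‖s i‖) (fun i _ => norm_nonneg _)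
      (Finset.mem_univ i)
    rw [Complex.norm_real, Real.norm_of_nonneg h2.le]
    linarith
  have f2 : ‖∏ i : Fin m, ((q : ℂ) + ((i : ℕ) + 1)) / σ‖ ≤ (2 / σ * q) ^ m := by
    rw [norm_prod]
    refine (Finset.prod_le_prod (g := fun _ => 2 / σ * q) (fun i _ => norm_nonneg _)
      fun i _ => ?_).trans_eq (by simp)
    rw [norm_div, Complex.norm_real, Real.norm_of_nonneg hσ.le, div_mul_eq_mul_div]
    refine div_le_div_of_nonneg_right ((norm_add_le _ _).trans ?_) hσ.le
    rw [Complex.norm_real, Real.norm_of_nonneg h2.le,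
      show (((i : ℕ) : ℂ) + 1) = (((i : ℕ) + 1 : ℕ) : ℂ) by push_cast; rfl, Complex.norm_natCast]
    have : (((i : ℕ) + 1 : ℕ) : ℝ) ≤ m := by exact_mod_cast i.2
    linarith
  have hΓ := Gamma_mul_rpow_le (x := q + 1) (by linarith) hσ
  rw [add_sub_cancel_right] at hΓ
  have g1 := Real.Gamma_pos_of_pos (show 0 < q + 1 by linarith)
  have g2 := Real.Gamma_pos_of_pos (show 0 < q + 1 + σ by linarith)
  have c1 : Complex.Gamma ((q : ℂ) + 1) = (Real.Gamma (q + 1) : ℂ) := by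
    rw [← Complex.Gamma_ofReal]; push_cast; rfl
  have c2 : Complex.Gamma ((q : ℂ) + σ + 1) = (Real.Gamma (q + 1 + σ) : ℂ) := by
    rw [← Complex.Gamma_ofReal]; push_cast; congr 1; ring
  have f3 : (Real.Gamma (q + 1 + σ))⁻¹ ≤ (Real.Gamma (q + 1))⁻¹ * q ^ (-σ) := by
    rw [Real.rpow_neg h2.le, ← mul_inv]
    exact inv_anti₀ (mul_pos g1 (Real.rpow_pos_of_pos h2 _)) hΓ
  rw [c1, c2]
  simp only [norm_mul, norm_div, norm_pow, Complex.norm_real, Real.norm_of_nonneg g1.le,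
    Real.norm_of_nonneg g2.le, pow_succ]
  have hpow : (2 / σ * q) ^ n * (2 / σ * q) ^ m * q ^ (-σ) =
      (2 / σ) ^ (n + m) * q ^ (-(σ - (m + n))) := by
    rw [← pow_add, mul_pow, mul_assoc, ← Real.rpow_natCast q, ← Real.rpow_add h2]
    congr 2
    push_cast
    ring
  have hprod := mul_le_mul f1 f2 (norm_nonneg _) (by positivity)
  rw [norm_prod, norm_prod] at hprod
  simp only [norm_div, Complex.norm_real] at hprod
  rw [norm_prod, norm_prod]
  simp only [norm_div, Complex.norm_real]
  have hq0 := Real.rpow_pos_of_pos h2 (-σ)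
  set G := ‖gammaProd σ m s (q : ℂ)‖
  calc _ ≤ ((2 / σ * q) ^ n * (2 / σ * q) ^ m * G) * ((Real.Gamma (q + 1))⁻¹ * q ^ (-σ)) *
        (‖x‖ ^ r * ‖x‖) := by
        rw [div_eq_mul_inv]
        refine mul_le_mul_of_nonneg_right (mul_le_mul ?_ f3 (by positivity) (by positivity))
          (by positivity)
        exact mul_le_mul_of_nonneg_right hprod (norm_nonneg _)
    _ = (((2 / σ * q) ^ n * (2 / σ * q) ^ m * q ^ (-σ)) * ‖x‖) *
        (G / Real.Gamma (q + 1) * ‖x‖ ^ r) := by ring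
    _ = ((2 / σ) ^ (n + m) * ‖x‖ * q ^ (-(σ - (m + n)))) *
        (G / Real.Gamma (q + 1) * ‖x‖ ^ r) := by rw [hpow]; ring
    _ ≤ _ := mul_le_mul_of_nonneg_right h1 (by positivity)

theorem powerDecay_gammaProd (hσ : 0 < σ) (hlt : m + n < σ) {κ : ℝ}
    (hκ : NonResonant σ m s κ) {C : ℝ} (hC : 0 < C) (c : ℂ) :
    PowerDecay Measure.count
      (fun r : ℕ => c * (gammaProd σ m s ((κ + σ * r : ℝ) : ℂ) /
        Complex.Gamma (((κ + σ * r : ℝ) : ℂ) + 1) * (C : ℂ) ^ r))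
      (fun r : ℕ => ((κ + σ * r : ℝ) : ℂ)) := by
  refine ⟨measurable_from_nat, measurable_from_nat, fun k z hz => ?_⟩
  rw [integrable_count_iff, summable_norm_iff]
  -- The series converges at every argument, so `z^(σr)` and the bound `exp(|κ| + σr)` for the
  -- polynomial factor can be put into the argument.
  have h := (summable_gammaProd_div_Gamma hσ hlt hκ
    ((C * Real.exp σ * z ^ σ : ℝ) : ℂ)).norm.mul_left
    (‖c‖ * (k.factorial / 1 ^ k * Real.exp 1 * Real.exp |κ|) * z ^ κ)
  refine Summable.of_nonneg_of_le (fun r => ?_) (fun r => ?_) h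
  · have := Real.rpow_pos_of_pos hz ((κ + σ * r : ℝ) : ℂ).re
    positivity
  · have h1 := one_add_pow_le_exp one_pos k (norm_nonneg ((κ + σ * r : ℝ) : ℂ))
    have h2 : 1 * ‖((κ + σ * r : ℝ) : ℂ)‖ ≤ |κ| + σ * r := by
      rw [one_mul, Complex.norm_real]
      refine (norm_add_le _ _).trans_eq ?_
      rw [Real.norm_eq_abs, Real.norm_of_nonneg (by positivity)]
    have h3 := h1.trans (mul_le_mul_of_nonneg_left (Real.exp_le_exp.2 h2) (by positivity))
    have hzσ := Real.rpow_pos_of_pos hz σ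
    have e1 : ‖((C * Real.exp σ * z ^ σ : ℝ) : ℂ)‖ = C * Real.exp σ * z ^ σ := by
      rw [Complex.norm_real, Real.norm_of_nonneg (by positivity)]
    have e2 : Real.exp (|κ| + σ * r) = Real.exp |κ| * Real.exp σ ^ r := by
      rw [Real.exp_add, ← Real.exp_nat_mul, mul_comm σ]
    have e3 : z ^ (κ + σ * r) = z ^ κ * (z ^ σ) ^ r := by
      rw [Real.rpow_add hz, Real.rpow_mul hz.le, Real.rpow_natCast]
    have hzκ := Real.rpow_pos_of_pos hz κ
    rw [norm_mul, norm_mul, norm_pow, norm_mul, norm_pow, e1, Complex.norm_real,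
      Real.norm_of_nonneg hC.le, Complex.ofReal_re, e3]
    set A := ‖gammaProd σ m s ((κ + σ * r : ℝ) : ℂ) / Complex.Gamma (((κ + σ * r : ℝ) : ℂ) + 1)‖
    calc _ ≤ ‖c‖ * (A * C ^ r) * (k.factorial / 1 ^ k * Real.exp 1 * Real.exp (|κ| + σ * r)) *
          (z ^ κ * (z ^ σ) ^ r) := by gcongr
      _ = _ := by rw [e2]; ring

/-- The series attached to an exponent `κ = α - k` solves the Euler equation. -/
theorem isEulerSolution_wright (hσ : 0 < σ) (hlt : m + n < σ) {α : ℝ} (hα : σ = α + m)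
    {a : ℕ → ℝ} (han : 0 < a n) (hs : (eulerCharPoly n a).roots = Finset.univ.val.map s)
    {k : ℕ} (hk : 1 ≤ k) (hkα : (k : ℝ) ≤ α + 1) (hκ : NonResonant σ m s (α - k)) (c : ℂ) :
    IsEulerSolution α m n a fun z : ℝ => c * ((z ^ (α - k) : ℝ) : ℂ) *
      ∑' r : ℕ, gammaProd σ m s ((α - k + σ * r : ℝ) : ℂ) /
        Complex.Gamma (((α - k + σ * r : ℝ) : ℂ) + 1) *
          ((a n * σ ^ (m + n) * z ^ σ : ℝ) : ℂ) ^ r := by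
  have hC : 0 < a n * σ ^ (m + n) := by positivity
  set C := a n * σ ^ (m + n) with hCdef
  -- If `k < α + 1`, all exponents exceed `-1`. If `k = α + 1`, the exponent at `r = 0` is `-1`, but
  -- its weight contains `1/Γ(0) = 0`, and the next exponent is `σ - 1`.
  have hε : ∃ ε, 0 < ε ∧ ∀ r : ℕ, c * (gammaProd σ m s ((α - k + σ * r : ℝ) : ℂ) /
        Complex.Gamma (((α - k + σ * r : ℝ) : ℂ) + 1) * (C : ℂ) ^ r) ≠ 0 →
      ε ≤ (((α - k + σ * r : ℝ) : ℂ) + 1).re := by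
    simp only [Complex.add_re, Complex.ofReal_re, Complex.one_re]
    rcases hkα.lt_or_eq with h | h
    · refine ⟨α - k + 1, by linarith, fun r _ => ?_⟩
      have : 0 ≤ σ * r := by positivity
      linarith
    · refine ⟨σ, hσ, fun r hr => ?_⟩
      have hr0 : r ≠ 0 := by
        rintro rfl
        have : ((α - k + σ * (0 : ℕ) : ℝ) : ℂ) + 1 = 0 := by
          rw [h]; push_cast; ring
        rw [this, Complex.Gamma_zero] at hr
        simp at hr
      have : (1 : ℝ) ≤ r := by exact_mod_cast Nat.one_le_iff_ne_zero.2 hr0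
      nlinarith
  obtain ⟨ε, hε0, hε⟩ := hε
  refine IsEulerSolution.congr ((powerDecay_gammaProd hσ hlt hκ hC c).isEulerSolution
    hε0 hε α m n a fun z hz => ?_) fun z hz => ?_
  · have hz' : (z : ℂ) ≠ 0 := by exact_mod_cast hz.ne'
    rw [powInt, powInt, integral_count_eq_tsum, integral_count_eq_tsum,
      ← (add_left_injective 1).tsum_eq ]
    · refine tsum_congr fun r => ?_
      have hstep : (((α - k + σ * (r + 1 : ℕ) : ℝ)) : ℂ) = ((α - k + σ * r : ℝ) : ℂ) + σ := by
        push_cast; ring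
      have hΓ : Complex.Gamma (((α - k + σ * (r + 1 : ℕ) : ℝ) : ℂ) + 1) ≠ 0 := by
        refine Complex.Gamma_ne_zero_of_re_pos ?_
        simp only [Complex.add_re, Complex.ofReal_re, Complex.one_re]
        have : 0 ≤ σ * r := by positivity
        push_cast
        linarith
      have hrec := gammaProd_add_div_Gamma hσ.ne' m han hs (hκ r).1 (hκ r).2
      rw [← hCdef] at hrec
      rw [hstep] at hΓ ⊢
      have hσc : (σ : ℂ) = α + m := by rw [hα]; push_cast; ring
      set q : ℂ := ((α - k + σ * r : ℝ) : ℂ)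
      have e1 : q + σ + 1 - α = q + 1 + m := by rw [hσc]; ring
      have e2 : q + σ - α = q + m := by rw [hσc]; ring
      rw [e1, e2, pow_succ]
      have e3 : gammaProd σ m s (q + σ) / Complex.Gamma (q + σ + 1) *
          (Complex.Gamma (q + σ + 1) / Complex.Gamma (q + 1 + m)) =
          gammaProd σ m s (q + σ) / Complex.Gamma (q + 1 + m) := by field_simp
      linear_combination (c * (C : ℂ) ^ r * C * (z : ℂ) ^ (q + m)) * e3 +
        (c * (C : ℂ) ^ r * (z : ℂ) ^ (q + m)) * hrec
    -- Only `r = 0` is missed by the reindexing `r ↦ r + 1`. Its term is zero because `1/Γ(1-k) =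
    -- 0`.
    · intro r hr
      rcases r with _ | r
      · refine absurd ?_ hr
        have : ((α - k + σ * (0 : ℕ) : ℝ) : ℂ) + 1 - α = -((k - 1 : ℕ) : ℂ) := by
          rw [Nat.cast_sub hk]; push_cast; ring
        simp only [this, Complex.Gamma_neg_nat_eq_zero, div_zero, mul_zero, zero_mul]
      · exact ⟨r, rfl⟩
  · rw [powInt, integral_count_eq_tsum, ← tsum_mul_left]
    refine tsum_congr fun r => ?_
    have e3 : (z : ℂ) ^ ((α - k + σ * r : ℝ) : ℂ) =
        ((z ^ (α - k) : ℝ) : ℂ) * ((z ^ σ : ℝ) : ℂ) ^ r := by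
      rw [← Complex.ofReal_cpow hz.le, Real.rpow_add hz, Real.rpow_mul hz.le, Real.rpow_natCast]
      push_cast
      rfl
    rw [e3]
    push_cast
    ring

/-- Of all the poles only the one at `0` matters for the recursion. -/
theorem WrightDefined.nonResonant {α : ℝ} {k : ℕ} (hσ : 0 < α + m)
    (h : WrightDefined (psiUpper α m n s k)) : NonResonant (α + m) m s (α - k) := by
  have hσ' : ((α + m : ℝ) : ℂ) ≠ 0 := by exact_mod_cast hσ.ne'
  refine fun r => ⟨fun i h0 => ?_, fun i h0 => ?_⟩
  · have := h (Fin.castAdd 1 (Fin.castAdd m i)) r 0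
    simp only [psiUpper, Fin.append_left, Complex.ofReal_one, one_mul, Nat.cast_zero,
      neg_zero] at this
    refine this ?_
    rw [← h0, Complex.ofReal_add (α - k), Complex.ofReal_mul]
    push_cast at hσ' ⊢
    field_simp
    ring
  · have := h (Fin.castAdd 1 (Fin.natAdd n i)) r 0
    simp only [psiUpper, Fin.append_left, Fin.append_right, Complex.ofReal_one, one_mul,
      Nat.cast_zero, neg_zero] at this
    refine this ?_
    rw [← h0]
    push_cast at hσ' ⊢
    field_simp
    ring

/-- The pair `(1,1)` contributes `Γ(1+r) = r!`, which cancels the factorial of the Wright series. -/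
theorem wrightTerm_eq {α : ℝ} (hσ : 0 < α + m) (s : Fin n → ℂ) (k : ℕ) (x : ℂ) (r : ℕ) :
    wrightTerm (psiUpper α m n s k) (psiLower α m k) x r =
      gammaProd (α + m) m s ((α - k + (α + m) * r : ℝ) : ℂ) /
        Complex.Gamma (((α - k + (α + m) * r : ℝ) : ℂ) + 1) * x ^ r := by
  have hσ' : ((α + m : ℝ) : ℂ) ≠ 0 := by exact_mod_cast hσ.ne'
  have hr : ((r.factorial : ℕ) : ℂ) ≠ 0 := by exact_mod_cast r.factorial_ne_zero
  have e1 : Complex.Gamma (1 + (r : ℂ)) = r.factorial := by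
    rw [add_comm, Complex.Gamma_nat_eq_factorial]
  have e2 : ∀ i, (((α - k : ℝ) : ℂ) - s i) / ((α + m : ℝ) : ℂ) + r =
      (((α - k + (α + m) * r : ℝ) : ℂ) - s i) / ((α + m : ℝ) : ℂ) := fun i => by
    push_cast at hσ' ⊢
    field_simp
    ring
  have e3 : ∀ i : Fin m, (((α - k + ((i : ℕ) + 1 : ℝ)) / (α + m) : ℝ) : ℂ) + r =
      (((α - k + (α + m) * r : ℝ) : ℂ) + ((i : ℕ) + 1)) / ((α + m : ℝ) : ℂ) := fun i => by
    push_cast at hσ' ⊢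
    field_simp
    ring
  have e4 : ((1 + α - k : ℝ) : ℂ) + ((α + m : ℝ) : ℂ) * r =
      ((α - k + (α + m) * r : ℝ) : ℂ) + 1 := by push_cast; ring
  rw [wrightTerm, Fin.prod_univ_add, Fin.prod_univ_add]
  simp only [psiUpper, psiLower, Fin.append_left, Fin.append_right, Finset.univ_unique,
    Finset.prod_const, Finset.card_singleton, pow_one, Complex.ofReal_one, one_mul, e1, e2, e3, e4,
    gammaProd]
  field_simp

end WrightSeries

/-! ### The theorem -/

theorem proposition1 (α : ℝ) (hα : 0 < α) (m n : ℕ) (a : ℕ → ℝ) (han : 0 < a n)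
    (s : Fin n → ℂ)
    (hs : (eulerCharPoly n a).roots = Finset.univ.val.map s) :
    (α < n →
      (∃ γ : ℝ, FoxHSeparates (m + n) 0 (hUpper α m) (hLower α m n s) γ) ∧
      ∀ γ : ℝ, FoxHSeparates (m + n) 0 (hUpper α m) (hLower α m n s) γ →
        (∀ x : ℝ, 0 < x → FoxHConverges (m + n) 0 (hUpper α m) (hLower α m n s) γ (x : ℂ)) ∧
        ∀ c₁ : ℂ, IsEulerSolution α m n a (fun z : ℝ =>
          c₁ * foxH (m + n) 0 (hUpper α m) (hLower α m n s) γ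
            ((z ^ (-(α + m)) / (a n * (α + m) ^ (m + n)) : ℝ) : ℂ))) ∧
    ((n : ℝ) < α →
      (∀ k ∈ Finset.Icc 1 (⌊α⌋₊ + 1), WrightDefined (psiUpper α m n s k) →
        ∀ x : ℂ, Summable (wrightTerm (psiUpper α m n s k) (psiLower α m k) x)) ∧
      ∀ c : ℕ → ℂ,
        (∀ k ∈ Finset.Icc 1 (⌊α⌋₊ + 1), c k ≠ 0 → WrightDefined (psiUpper α m n s k)) →
        IsEulerSolution α m n a (fun z : ℝ =>
          ∑ k ∈ Finset.Icc 1 (⌊α⌋₊ + 1), c k * ((z ^ (α - k) : ℝ) : ℂ) *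
            wrightPsi (psiUpper α m n s k) (psiLower α m k)
              ((a n * (α + m) ^ (m + n) * z ^ (α + m) : ℝ) : ℂ))) := by
  have hσ : 0 < α + m := by positivity
  refine ⟨fun hlt => ⟨?_, fun γ hγ => ?_⟩, fun hlt => ⟨fun k _ hk x => ?_, fun c hc => ?_⟩⟩
  · simpa only [foxHSeparates_iff] using exists_leftOfPoles (α + m) m s
  · rw [foxHSeparates_iff] at hγ
    have hlt' : α + m < m + n := by linarith
    refine ⟨fun x hx => ?_, fun c₁ => ?_⟩
    · simpa only [FoxHConverges, foxHIntegrand_eq m hσ] using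
        integrable_barnesKernel_vertical hσ hlt' 1 hγ hx
    -- The factor `i` from `ds = i dt` cancels the one in `1/(2πi)`.
    · refine (isEulerSolution_barnes hσ hlt' rfl han hs hγ (c₁ / (2 * Real.pi))).congr
        fun z _ => ?_
      simp only [foxH, foxHIntegrand_eq m hσ, integral_mul_const]
      have : (Real.pi : ℂ) ≠ 0 := by exact_mod_cast Real.pi_ne_zero
      field_simp
  · have := summable_gammaProd_div_Gamma hσ (by linarith) (hk.nonResonant hσ) x
    exact this.congr fun r => (wrightTerm_eq hσ s k x r).symm
  · refine IsEulerSolution.sum _ fun k hk => ?_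
    -- For `c k = 0` the Wright function may be undefined, but the summand is the zero solution.
    by_cases hck : c k = 0
    · simpa [hck] using IsEulerSolution.zero α m n a
    · rw [Finset.mem_Icc] at hk
      have hkα : (k : ℝ) ≤ α + 1 := by
        have h1 : (k : ℝ) ≤ (⌊α⌋₊ + 1 : ℕ) := by exact_mod_cast hk.2
        have h2 := Nat.floor_le hα.le
        push_cast at h1
        linarith
      have hd := (hc k (Finset.mem_Icc.2 hk) hck).nonResonant hσ
      simp only [wrightPsi, wrightTerm_eq hσ]
      exact isEulerSolution_wright hσ (by linarith) rfl han hs hk.1 hkα hd (c k)
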